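/- Let $n\ge 2$ and let $D\subset\mathbb{R}^n$ be a strongly convex domain with smooth boundary, i.e. a nonempty bounded open convex set whose boundary $\partial D$ is a $C^\infty$ hypersurface with positive definite second fundamental form. For $x\in D$ and $v\in T_xD=\mathbb{R}^n$, $v\neq0$, let $a=x+sv$ and $b=x+tv$ with $s<0<t$ be the two intersections of the line through $x$ in the direction $v$ with $\partial D$. The Hilbert metric of $D$ is $$F(x,v)=\frac{|v|}{2}\Big\{\frac1{|x-a|}+\frac1{|x-b|}\Big\},\qquad F(x,0)=0,$$ where $|\cdot|$ is the Euclidean norm. Put $g_{ij}(x,v)=\frac12\frac{\partial^2(F^2)}{\partial v^i\partial v^j}(x,v)$ for $v\ne0$. Let $\mathrm{Ric}(v)$ be the Finsler Ricci curvature of $F$, that is, the trace of its Riemann (flag) curvature. Let $m$ be the Lebesgue measure on $D$. For $v\in T_xD$ with $F(x,v)=1$, let $\eta:(-\varepsilon,\varepsilon)\to D$ be the geodesic with $\eta(0)=x$ and $\dot\eta(0)=v$ (a $C^\infty$ curve that is locally minimizing and has constant speed), write $m=e^{-\Psi}\sqrt{\det(g_{ij}(\eta,\dot\eta))}\,dx^1\cdots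 dx^n$ along $\eta$, and define the weighted Ricci curvatures $$\mathrm{Ric}_\infty(v)=\mathrm{Ric}(v)+\Psi''(0),\qquad \mathrm{Ric}_N(v)=\mathrm{Ric}(v)+\Psi''(0)-\frac{\Psi'(0)^2}{N-n}\quad\text{for } N\in(n,\infty).$$ Then $F$ is a $C^\infty$ Finsler structure on $D$ (nonnegative, $C^\infty$ for $v\neq 0$, positively $1$-homogeneous in $v$, and with $(g_{ij}(x,v))$ positive definite for $v\ne0$). Moreover, for every $x\in D$ and every $v\in T_xD$ with $F(x,v)=1$, the numbers $\mathrm{Ric}_\infty(v)$ and $\mathrm{Ric}_N(v)$ are well defined and $$\mathrm{Ric}_\infty(v)\in\big(-(n-1),\,2\big],\qquad \mathrm{Ric}_N(v)\in\Big(-(n-1)-\frac{(n+1)^2}{N-n},\,2\Big]\quad\text{for every } N\in(n,\infty).$$ In particular, these bounds do not depend on the domain $D$. -/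

import Mathlib

open Set MeasureTheory
open scoped ContDiff Topology

noncomputable section

/-- The space `ℝⁿ` with its Euclidean norm. -/
abbrev Eucl (n : ℕ) : Type := EuclideanSpace ℝ (Fin n)

/-- A strongly convex domain of `ℝⁿ` with smooth boundary: a nonempty bounded open convex set whose
boundary is a smooth hypersurface of positive curvature. Near every boundary point `p`, the set `D`
is the negativity set of a smooth function `ρ` with nonvanishing differential at `p`, and the
Hessian of `ρ` at `p` (a positive multiple of the second fundamental form of the boundary) is
positive definite on the tangent space `ker dρ(p)` of the boundary. -/
structure IsStronglyConvexDomain {n : ℕ} (D : Set (Eucl n)) : Prop where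
  nonempty : D.Nonempty
  isOpen : IsOpen D
  isBounded : Bornology.IsBounded D
  convex : Convex ℝ D
  boundary : ∀ p ∈ frontier D, ∃ (U : Set (Eucl n)) (ρ : Eucl n → ℝ),
    IsOpen U ∧ p ∈ U ∧ ContDiffOn ℝ ∞ ρ U ∧ D ∩ U = {x ∈ U | ρ x < 0} ∧
    fderiv ℝ ρ p ≠ 0 ∧
    ∀ w : Eucl n, w ≠ 0 → fderiv ℝ ρ p w = 0 → 0 < fderiv ℝ (fderiv ℝ ρ) p w w

/-- The parameter `t > 0` at which the ray `x + t v` meets the boundary of `D`. For `D` bounded,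
open and convex, `x ∈ D` and `v ≠ 0`, there is exactly one such `t`. -/
def boundaryTime {n : ℕ} (D : Set (Eucl n)) (x v : Eucl n) : ℝ :=
  sInf {t : ℝ | 0 < t ∧ x + t • v ∈ frontier D}

/-- The point at which the ray from `x` in the direction `v` meets the boundary of `D`. -/
def boundaryPoint {n : ℕ} (D : Set (Eucl n)) (x v : Eucl n) : Eucl n :=
  x + boundaryTime D x v • v

/-- The Hilbert metric `F(x, v) = (|v| / 2) (1 / |x - a| + 1 / |x - b|)` of `D`, where `a` and `b`
are the points at which the line through `x` in the direction `v` meets the boundary of `D`. -/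
def hilbertMetric {n : ℕ} (D : Set (Eucl n)) (x v : Eucl n) : ℝ :=
  ‖v‖ / 2 * (1 / ‖x - boundaryPoint D x (-v)‖ + 1 / ‖x - boundaryPoint D x v‖)

/-! Finsler geometry of a function `F` on the tangent bundle `D × ℝⁿ` of an open set `D` of `ℝⁿ`,
in the standard coordinates `(xⁱ, vʲ)`. -/

/-- The partial derivative `∂f/∂xᵏ` of a function `f(x, v)`. -/
def partialX {n : ℕ} (k : Fin n) (f : Eucl n → Eucl n → ℝ) (x v : Eucl n) : ℝ :=
  lineDeriv ℝ (fun y => f y v) x (EuclideanSpace.single k 1)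

/-- The partial derivative `∂f/∂vᵏ` of a function `f(x, v)`. -/
def partialV {n : ℕ} (k : Fin n) (f : Eucl n → Eucl n → ℝ) (x v : Eucl n) : ℝ :=
  lineDeriv ℝ (fun w => f x w) v (EuclideanSpace.single k 1)

/-- The function `F²`. -/
def energy {n : ℕ} (F : Eucl n → Eucl n → ℝ) (x v : Eucl n) : ℝ := F x v ^ 2

/-- The fundamental tensor `g_ij(v) = (1/2) ∂²(F²)/∂vⁱ∂vʲ` at `v ∈ T_x D`. -/
def fundamentalTensor {n : ℕ} (F : Eucl n → Eucl n → ℝ) (x v : Eucl n) :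
    Matrix (Fin n) (Fin n) ℝ :=
  Matrix.of fun i j => 1 / 2 * partialV i (partialV j (energy F)) x v

/-- `F` is a smooth Finsler structure on the open set `D`. -/
structure IsFinslerStructure {n : ℕ} (D : Set (Eucl n)) (F : Eucl n → Eucl n → ℝ) : Prop where
  nonneg : ∀ x ∈ D, ∀ v, 0 ≤ F x v
  smooth : ContDiffOn ℝ ∞ (fun p : Eucl n × Eucl n => F p.1 p.2) (D ×ˢ {v | v ≠ 0})
  homogeneous : ∀ x ∈ D, ∀ v, ∀ c : ℝ, 0 < c → F x (c • v) = c * F x v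
  posDef : ∀ x ∈ D, ∀ v, v ≠ 0 → (fundamentalTensor F x v).PosDef

/-- The distance from `x` to `y`: the infimum of the lengths of the `C¹` curves `[0, 1] → D`
from `x` to `y`. -/
def finslerDist {n : ℕ} (D : Set (Eucl n)) (F : Eucl n → Eucl n → ℝ) (x y : Eucl n) : ℝ :=
  sInf {L : ℝ | ∃ γ : ℝ → Eucl n, ContDiffOn ℝ 1 γ (Icc 0 1) ∧ MapsTo γ (Icc 0 1) D ∧
    γ 0 = x ∧ γ 1 = y ∧ L = ∫ t in (0 : ℝ)..1, F (γ t) (derivWithin γ (Icc 0 1) t)}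

/-- `η` is a geodesic of `(D, F)` on the open interval `I`: a smooth curve in `D` of constant speed
which is locally minimizing. -/
structure IsGeodesicOn {n : ℕ} (D : Set (Eucl n)) (F : Eucl n → Eucl n → ℝ) (I : Set ℝ)
    (η : ℝ → Eucl n) : Prop where
  smooth : ContDiffOn ℝ ∞ η I
  mapsTo : MapsTo η I D
  constSpeed : ∃ c : ℝ, ∀ t ∈ I, F (η t) (deriv η t) = c
  locallyMinimizing : ∀ t ∈ I, ∃ δ > 0, ∀ s₁ ∈ I ∩ Ioo (t - δ) (t + δ),
    ∀ s₂ ∈ I ∩ Ioo (t - δ) (t + δ), s₁ ≤ s₂ →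
      ∫ s in s₁..s₂, F (η s) (deriv η s) = finslerDist D F (η s₁) (η s₂)

/-- The geodesic spray coefficients
`Gⁱ = (1/4) ∑ₗ gⁱˡ (∑ₖ vᵏ ∂²(F²)/∂xᵏ∂vˡ - ∂(F²)/∂xˡ)`. -/
def sprayCoeff {n : ℕ} (F : Eucl n → Eucl n → ℝ) (i : Fin n) (x v : Eucl n) : ℝ :=
  1 / 4 * ∑ l, (fundamentalTensor F x v)⁻¹ i l *
    ((∑ k, v k * partialX k (partialV l (energy F)) x v) - partialX l (energy F) x v)

/-- The nonlinear connection `Nⁱⱼ = ∂Gⁱ/∂vʲ`. -/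
def nonlinearConnection {n : ℕ} (F : Eucl n → Eucl n → ℝ) (i j : Fin n) (x v : Eucl n) : ℝ :=
  partialV j (sprayCoeff F i) x v

/-- The Riemann curvature `Rⁱₖ(v)` of `F`, that is, the contraction `∑ vʲ vˡ Rⱼⁱₖₗ` of the curvature
of the Chern connection:
`Rⁱₖ = 2 ∂Gⁱ/∂xᵏ - ∑ⱼ vʲ ∂Nⁱₖ/∂xʲ + 2 ∑ⱼ Gʲ ∂Nⁱₖ/∂vʲ - ∑ⱼ Nⁱⱼ Nʲₖ`. Its value
`g_v(R_v(w), w)`, divided by `F(v)² g_v(w, w) - g_v(v, w)²`, is the flag curvature. -/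
def riemannCurvature {n : ℕ} (F : Eucl n → Eucl n → ℝ) (i k : Fin n) (x v : Eucl n) : ℝ :=
  2 * partialX k (sprayCoeff F i) x v
    - ∑ j, v j * partialX j (nonlinearConnection F i k) x v
    + 2 * ∑ j, sprayCoeff F j x v * partialV j (nonlinearConnection F i k) x v
    - ∑ j, nonlinearConnection F i j x v * nonlinearConnection F j k x v

/-- The Finsler Ricci curvature `Ric(v)` of `v ∈ T_x D`, the trace of the Riemann curvature. -/
def finslerRicci {n : ℕ} (F : Eucl n → Eucl n → ℝ) (x v : Eucl n) : ℝ :=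
  ∑ i, riemannCurvature F i i x v

/-- The measure `m` on `D` is positive and smooth, with density `σ` in the coordinates `xⁱ`. -/
structure IsSmoothDensity {n : ℕ} (D : Set (Eucl n)) (m : Measure (Eucl n)) (σ : Eucl n → ℝ) :
    Prop where
  smooth : ContDiffOn ℝ ∞ σ D
  pos : ∀ x ∈ D, 0 < σ x
  eq_withDensity :
    m.restrict D = (volume.restrict D).withDensity (fun x => ENNReal.ofReal (σ x))

/-- `η` is a geodesic on `(-ε, ε)` with initial velocity `v ∈ T_x D`, and `Ψ` is the weight function
on `(-ε, ε)` with `m = e^{-Ψ} vol` along `η`, where `vol = √det(g_ij) dx¹ ⋯ dxⁿ` is the Riemannian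
volume of the Riemannian structure `g` that the velocity of `η` induces. -/
structure IsWeightAlong {n : ℕ} (D : Set (Eucl n)) (F : Eucl n → Eucl n → ℝ)
    (m : Measure (Eucl n)) (x v : Eucl n) (ε : ℝ) (η : ℝ → Eucl n) (Ψ : ℝ → ℝ) : Prop where
  pos : 0 < ε
  geodesic : IsGeodesicOn D F (Ioo (-ε) ε) η
  start : η 0 = x
  velocity : deriv η 0 = v
  weight : ∃ σ : Eucl n → ℝ, IsSmoothDensity D m σ ∧ ∀ t ∈ Ioo (-ε) ε,
    σ (η t) = Real.exp (-Ψ t) * Real.sqrt (fundamentalTensor F (η t) (deriv η t)).det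

/-- `r` is the weighted Ricci curvature `Ric_∞(v) = Ric(v) + Ψ''(0)` of `(D, F, m)` at a unit vector
`v ∈ T_x D`. -/
def IsWeightedRicciTop {n : ℕ} (D : Set (Eucl n)) (F : Eucl n → Eucl n → ℝ)
    (m : Measure (Eucl n)) (x v : Eucl n) (r : ℝ) : Prop :=
  ∃ (ε : ℝ) (η : ℝ → Eucl n) (Ψ : ℝ → ℝ), IsWeightAlong D F m x v ε η Ψ ∧
    r = finslerRicci F x v + deriv (deriv Ψ) 0

/-- `r` is the weighted Ricci curvature `Ric_N(v) = Ric(v) + Ψ''(0) - Ψ'(0)² / (N - n)` of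
`(D, F, m)` at a unit vector `v ∈ T_x D`, for a real number `N > n`. -/
def IsWeightedRicci {n : ℕ} (D : Set (Eucl n)) (F : Eucl n → Eucl n → ℝ)
    (m : Measure (Eucl n)) (N : ℝ) (x v : Eucl n) (r : ℝ) : Prop :=
  ∃ (ε : ℝ) (η : ℝ → Eucl n) (Ψ : ℝ → ℝ), IsWeightAlong D F m x v ε η Ψ ∧
    r = finslerRicci F x v + deriv (deriv Ψ) 0 - deriv Ψ 0 ^ 2 / (N - n)

end

/-! ### Exit times through the gauge of the translated domain -/

section BoundaryTime

variable {n : ℕ} {D : Set (Eucl n)} {x v : Eucl n}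

/-! Write `T` and `T'` for the times at which the rays from `x` along `v` and `-v` leave `D`. The
Hilbert metric is the mean `F = (k + k') / 2` of the Funk metric `k = 1 / T` and its reverse `k' = 1
/ T'`. The implicit function theorem makes both smooth. Positivity of the second fundamental form
makes their vertical Hessians positive transversally to `v`, and hence `g` positive definite.

Everything else rests on Okada's equation `∂ₓk = k ∂ᵥk` (`pd_funk_base`) and its mirror image `∂ₓk'
= -k' ∂ᵥk'`. They reduce base derivatives to fibre derivatives, and with Euler's identity they give:
(1) spray coefficients `Gⁱ = P vⁱ` with `P = (k - k') / 2` (`sprayCoeff_hilbertMetric`), hence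
`Ric(v) = (n - 1)(P² - v·∂ₓP) = -(n - 1) F²` (`finslerRicci_hilbertMetric`); (2) invariance of the
vertical Hessian of `F` along each line in its own direction, so that `det g` changes there only by
the factor `(F / F₀) ^ (n + 1)` (`det_fundamentalTensor_hilbertMetric_add_smul`).

Every pair of boundary points carries a closed form which is bounded by `F`, with equality exactly
on the line joining them (`exists_calibration`). Hence suitably parametrized lines are geodesics,
and every geodesic is locally such a line (`isGeodesicOn_line`, `IsGeodesicOn.exists_eq_line`). The
density of Lebesgue measure is forced to be `1` on `D`, so the weight along a unit speed geodesic is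
`Ψ = (n + 1) / 2 * log F + const`, with `F` taken in the fixed direction `v`. This gives `Ψ'(0) = (n
+ 1)(T' - T) / (T + T')` and `Ψ''(0) = 2 (n + 1) / (T + T')` (`IsWeightAlong.deriv_eq`),
independently of all choices.

The unit condition is `1/T + 1/T' = 2`, so `T + T' ≥ 2`. Therefore `0 < Ψ''(0) ≤ n + 1` and `|Ψ'(0)|
< n + 1`, and the bounds follow from `Ric(v) = -(n - 1)`. -/

theorem translate_mem_nhds_zero (hD : IsOpen D) (hx : x ∈ D) :
    (fun y => x + y) ⁻¹' D ∈ 𝓝 (0 : Eucl n) :=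
  (hD.preimage (continuous_const_add x)).mem_nhds (by simpa using hx)

theorem gauge_translate_pos (hD : IsStronglyConvexDomain D) (hx : x ∈ D) (hv : v ≠ 0) :
    0 < gauge ((fun y => x + y) ⁻¹' D) v := by
  have hb : Bornology.IsBounded ((fun y => x + y) ⁻¹' D) := by
    have : (fun y => x + y) ⁻¹' D = (fun y => -x + y) '' D := by
      ext y
      simp
    rw [this]
    have h := hD.isBounded
    rw [isBounded_iff_forall_norm_le] at h ⊢
    obtain ⟨C, hC⟩ := h
    refine ⟨‖-x‖ + C, ?_⟩
    rintro _ ⟨y, hy, rfl⟩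
    exact (norm_add_le _ _).trans (by gcongr; exact hC y hy)
  rw [gauge_pos (absorbent_nhds_zero (translate_mem_nhds_zero hD.isOpen hx))
    (NormedSpace.isVonNBounded_of_isBounded ℝ hb)]
  exact hv

theorem add_smul_mem_frontier_iff (hD : IsStronglyConvexDomain D) (hx : x ∈ D) {t : ℝ}
    (ht : 0 < t) :
    x + t • v ∈ frontier D ↔ t * gauge ((fun y => x + y) ⁻¹' D) v = 1 := by
  have h := gauge_eq_one_iff_mem_frontier (x := t • v) (hD.convex.translate_preimage_right x)
    (translate_mem_nhds_zero hD.isOpen hx)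
  rw [gauge_smul_of_nonneg ht.le, smul_eq_mul] at h
  rw [h, show (fun y => x + y) = (Homeomorph.addLeft x) from rfl, ← Homeomorph.preimage_frontier]
  rfl

theorem add_smul_mem_iff (hD : IsStronglyConvexDomain D) (hx : x ∈ D) {t : ℝ} (ht : 0 ≤ t) :
    x + t • v ∈ D ↔ t * gauge ((fun y => x + y) ⁻¹' D) v < 1 := by
  have h := gauge_lt_one_iff_mem_interior (x := t • v) (hD.convex.translate_preimage_right x)
    (translate_mem_nhds_zero hD.isOpen hx)
  rw [gauge_smul_of_nonneg ht, smul_eq_mul,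
    (hD.isOpen.preimage (continuous_const_add x)).interior_eq] at h
  rw [h]
  rfl

/-- The translate of `D` by `-x` is a convex neighbourhood of `0`, whose frontier is the level set
`1` of its gauge. For `v = 0` the ray never reaches the frontier, and both sides take the default
value `0`. -/
theorem boundaryTime_eq_inv_gauge (hD : IsStronglyConvexDomain D) (hx : x ∈ D) (v : Eucl n) :
    boundaryTime D x v = (gauge ((fun y => x + y) ⁻¹' D) v)⁻¹ := by
  rcases eq_or_ne v 0 with rfl | hv
  · have : {t : ℝ | 0 < t ∧ x + t • (0 : Eucl n) ∈ frontier D} = ∅ := by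
      ext t
      simp only [smul_zero, add_zero, mem_ofPred_eq, mem_empty_iff_false, iff_false, not_and]
      intro _ h
      exact (hD.isOpen.frontier_eq ▸ h).2 hx
    rw [boundaryTime, this]
    simp
  · have hg := gauge_translate_pos hD hx hv
    have : {t : ℝ | 0 < t ∧ x + t • v ∈ frontier D} =
        {(gauge ((fun y => x + y) ⁻¹' D) v)⁻¹} := by
      ext t
      simp only [mem_ofPred_eq, mem_singleton_iff]
      constructor
      · rintro ⟨ht, h⟩
        exact eq_inv_of_mul_eq_one_left ((add_smul_mem_frontier_iff hD hx ht).1 h)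
      · rintro rfl
        exact ⟨inv_pos.2 hg, (add_smul_mem_frontier_iff hD hx (inv_pos.2 hg)).2
          (inv_mul_cancel₀ hg.ne')⟩
    rw [boundaryTime, this, csInf_singleton]

theorem boundaryTime_pos (hD : IsStronglyConvexDomain D) (hx : x ∈ D) (hv : v ≠ 0) :
    0 < boundaryTime D x v := by
  rw [boundaryTime_eq_inv_gauge hD hx]
  exact inv_pos.2 (gauge_translate_pos hD hx hv)

theorem boundaryPoint_mem_frontier (hD : IsStronglyConvexDomain D) (hx : x ∈ D) (hv : v ≠ 0) :
    boundaryPoint D x v ∈ frontier D := by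
  rw [boundaryPoint, add_smul_mem_frontier_iff hD hx (boundaryTime_pos hD hx hv),
    boundaryTime_eq_inv_gauge hD hx]
  exact inv_mul_cancel₀ (gauge_translate_pos hD hx hv).ne'

theorem boundaryTime_eq_of_mem_frontier (hD : IsStronglyConvexDomain D) (hx : x ∈ D) {t : ℝ}
    (ht : 0 < t) (h : x + t • v ∈ frontier D) : boundaryTime D x v = t := by
  rw [boundaryTime_eq_inv_gauge hD hx]
  exact (eq_inv_of_mul_eq_one_left ((add_smul_mem_frontier_iff hD hx ht).1 h)).symm

theorem add_smul_mem_of_lt_boundaryTime (hD : IsStronglyConvexDomain D) (hx : x ∈ D) {t : ℝ}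
    (ht : 0 ≤ t) (h : t < boundaryTime D x v) : x + t • v ∈ D := by
  rw [add_smul_mem_iff hD hx ht]
  rcases eq_or_ne v 0 with rfl | hv
  · simp
  · rw [boundaryTime_eq_inv_gauge hD hx] at h
    rwa [← lt_div_iff₀ (gauge_translate_pos hD hx hv), one_div]

theorem boundaryTime_smul (hD : IsStronglyConvexDomain D) (hx : x ∈ D) {c : ℝ} (hc : 0 ≤ c)
    (v : Eucl n) : boundaryTime D x (c • v) = c⁻¹ * boundaryTime D x v := by
  rw [boundaryTime_eq_inv_gauge hD hx, boundaryTime_eq_inv_gauge hD hx, gauge_smul_of_nonneg hc,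
    smul_eq_mul, mul_inv]

end BoundaryTime

/-! ### Boundary points are exposed -/

section Support

variable {n : ℕ} {D : Set (Eucl n)} {p : Eucl n}

/-- A local defining function for the boundary of `D` at the point `p`. -/
structure IsDefiningAt (D : Set (Eucl n)) (p : Eucl n) (ρ : Eucl n → ℝ) : Prop where
  contDiffAt : ContDiffAt ℝ ∞ ρ p
  mem_iff : ∀ᶠ y in 𝓝 p, y ∈ D ↔ ρ y < 0
  fderiv_ne : fderiv ℝ ρ p ≠ 0
  hessian_pos : ∀ w : Eucl n, w ≠ 0 → fderiv ℝ ρ p w = 0 → 0 < fderiv ℝ (fderiv ℝ ρ) p w w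

theorem IsStronglyConvexDomain.exists_isDefiningAt (hD : IsStronglyConvexDomain D)
    (hp : p ∈ frontier D) : ∃ ρ, IsDefiningAt D p ρ := by
  obtain ⟨U, ρ, hU, hpU, hρ, hDU, h1, h2⟩ := hD.boundary p hp
  refine ⟨ρ, hρ.contDiffAt (hU.mem_nhds hpU), ?_, h1, h2⟩
  filter_upwards [hU.mem_nhds hpU] with y hy
  have := Set.ext_iff.1 hDU y
  simp only [mem_inter_iff, mem_ofPred_eq] at this
  tauto

namespace IsDefiningAt

variable {ρ : Eucl n → ℝ}

/-- If `ρ y > 0`, then `ρ > 0` near `y` by continuity, so that no point of `D` is near `y`. Closed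
segments ending at `p` are tested against this form. -/
theorem eventually_nonpos (h : IsDefiningAt D p ρ) : ∀ᶠ y in 𝓝 p, y ∈ closure D → ρ y ≤ 0 := by
  have hc : ∀ᶠ y in 𝓝 p, ContinuousAt ρ y := by
    have := (h.contDiffAt.of_le (m := 1) (by norm_cast)).eventually (by simp)
    filter_upwards [this] with y hy using hy.continuousAt
  filter_upwards [hc, h.mem_iff.eventually_nhds] with y hy hm hyD
  by_contra! hpos
  have := hy.eventually_const_lt hpos
  have hfr := mem_closure_iff_frequently.1 hyD
  obtain ⟨z, hz, hz1, hz2⟩ := (hfr.and_eventually (this.and hm)).exists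
  exact absurd (hz2.1 hz) (not_lt.2 hz1.le)

theorem apply_eq_zero (h : IsDefiningAt D p ρ) (hD : IsOpen D) (hp : p ∈ frontier D) :
    ρ p = 0 := by
  rw [hD.frontier_eq] at hp
  exact le_antisymm (h.eventually_nonpos.self_of_nhds hp.1)
    (not_lt.1 fun h' => hp.2 (h.mem_iff.self_of_nhds.2 h'))

theorem hasFDerivAt (h : IsDefiningAt D p ρ) : HasFDerivAt ρ (fderiv ℝ ρ p) p :=
  (h.contDiffAt.differentiableAt (by simp)).hasFDerivAt

/-- The half-open segment from `p` towards `y` lies in `D`, where `ρ` is below its value `0` at `p`.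
Its one-sided slope at `p` therefore cannot be positive. -/
theorem fderiv_apply_le (h : IsDefiningAt D p ρ) (hD : IsOpen D) (hc : Convex ℝ D)
    (hp : p ∈ frontier D) {y : Eucl n} (hy : y ∈ D) : fderiv ℝ ρ p (y - p) ≤ 0 := by
  have h0 := h.apply_eq_zero hD hp
  have hd : HasDerivAt (fun t : ℝ => ρ (p + t • (y - p))) (fderiv ℝ ρ p (y - p)) 0 :=
    (h.hasFDerivAt).hasLineDerivAt (y - p)
  have hcont : Filter.Tendsto (fun t : ℝ => p + t • (y - p)) (𝓝 0) (𝓝 p) := by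
    have : Continuous (fun t : ℝ => p + t • (y - p)) := by fun_prop
    simpa using this.tendsto 0
  by_contra! hpos
  have h1 : ∀ᶠ t in 𝓝[>] (0 : ℝ), 0 < ρ (p + t • (y - p)) := by
    have := (hasDerivAt_iff_tendsto_slope.1 hd).mono_left
      (nhdsWithin_mono 0 (fun t (ht : t ∈ Ioi (0 : ℝ)) => ne_of_gt ht))
    filter_upwards [this.eventually (lt_mem_nhds hpos), self_mem_nhdsWithin] with t ht ht0
    have ht0 : 0 < t := ht0
    simp only [slope, vsub_eq_sub, sub_zero, zero_smul, add_zero, h0, smul_eq_mul] at ht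
    exact (pos_iff_pos_of_mul_pos ht).1 (inv_pos.2 ht0)
  have h2 : ∀ᶠ t in 𝓝[>] (0 : ℝ), ρ (p + t • (y - p)) ≤ 0 := by
    filter_upwards [nhdsWithin_le_nhds (hcont.eventually h.mem_iff), self_mem_nhdsWithin,
      nhdsWithin_le_nhds (gt_mem_nhds (zero_lt_one' ℝ))] with t ht ht0 ht1
    refine (ht.1 ?_).le
    have := hc.add_smul_sub_mem_interior' (hD.frontier_eq ▸ hp).1 (hD.interior_eq.symm ▸ hy)
      ⟨ht0, le_of_lt ht1⟩
    exact interior_subset this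
  obtain ⟨t, ht1, ht2⟩ := (h1.and h2).exists
  linarith

/-- Openness makes the weak inequality strict: `y` can be pushed slightly in a direction where the
differential is positive without leaving `D`. -/
theorem fderiv_apply_lt (h : IsDefiningAt D p ρ) (hD : IsOpen D) (hc : Convex ℝ D)
    (hp : p ∈ frontier D) {y : Eucl n} (hy : y ∈ D) : fderiv ℝ ρ p y < fderiv ℝ ρ p p := by
  obtain ⟨w, hw⟩ : ∃ w, 0 < fderiv ℝ ρ p w := by
    by_contra! hcon
    refine h.fderiv_ne (ContinuousLinearMap.ext fun w => le_antisymm (hcon w) ?_)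
    have := hcon (-w)
    simp only [map_neg] at this
    simpa using this
  have hcont : Filter.Tendsto (fun t : ℝ => y + t • w) (𝓝[>] 0) (𝓝 y) := by
    have : Continuous (fun t : ℝ => y + t • w) := by fun_prop
    have := this.tendsto 0
    simp only [zero_smul, add_zero] at this
    exact this.mono_left nhdsWithin_le_nhds
  obtain ⟨t, ht, ht0⟩ := ((hcont.eventually (hD.mem_nhds hy)).and self_mem_nhdsWithin).exists
  have ht0 : 0 < t := ht0
  have := h.fderiv_apply_le hD hc hp ht
  simp only [map_sub, map_add, map_smul, smul_eq_mul] at this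
  nlinarith [mul_pos ht0 hw]

theorem fderiv_apply_le_of_mem_closure (h : IsDefiningAt D p ρ) (hD : IsOpen D)
    (hc : Convex ℝ D) (hp : p ∈ frontier D) {y : Eucl n} (hy : y ∈ closure D) :
    fderiv ℝ ρ p y ≤ fderiv ℝ ρ p p := by
  refine closure_minimal (t := {z | fderiv ℝ ρ p z ≤ fderiv ℝ ρ p p})
    (fun z hz => (h.fderiv_apply_lt hD hc hp hz).le) ?_ hy
  exact isClosed_le (fderiv ℝ ρ p).continuous continuous_const

/-- Along a tangent direction the first derivative of `ρ` vanishes and the second is positive, so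
`ρ` has to become positive. -/
theorem not_eventually_nonpos (h : IsDefiningAt D p ρ) (h0 : ρ p = 0) {w : Eucl n}
    (hw : w ≠ 0) (hw0 : fderiv ℝ ρ p w = 0) : ¬ ∀ᶠ t in 𝓝[>] (0 : ℝ), ρ (p + t • w) ≤ 0 := by
  have hdiff : ∀ᶠ y in 𝓝 p, DifferentiableAt ℝ ρ y := by
    have := (h.contDiffAt.of_le (m := 1) (by norm_cast)).eventually (by simp)
    filter_upwards [this] with y hy using hy.differentiableAt (by simp)
  have hline (t : ℝ) : HasDerivAt (fun t : ℝ => p + t • w) w t := by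
    simpa using ((hasDerivAt_id t).smul_const w).const_add p
  have hcont : Filter.Tendsto (fun t : ℝ => p + t • w) (𝓝 0) (𝓝 p) := by
    simpa using (hline 0).continuousAt.tendsto
  have hd1 : ∀ᶠ t in 𝓝 (0 : ℝ), HasDerivAt (fun t : ℝ => ρ (p + t • w))
      (fderiv ℝ ρ (p + t • w) w) t := by
    filter_upwards [hcont.eventually hdiff] with t ht
    exact ht.hasFDerivAt.comp_hasDerivAt t (hline t)
  have hd2 : HasDerivAt (fun t : ℝ => fderiv ℝ ρ (p + t • w) w)
      (fderiv ℝ (fderiv ℝ ρ) p w w) 0 := by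
    have h1 : ContDiffAt ℝ 1 (fderiv ℝ ρ) p := h.contDiffAt.fderiv_right (by norm_cast)
    have h2 : HasFDerivAt (fderiv ℝ ρ) (fderiv ℝ (fderiv ℝ ρ) p) (p + (0 : ℝ) • w) := by
      rw [zero_smul, add_zero]
      exact (h1.differentiableAt one_ne_zero).hasFDerivAt
    have h3 : HasDerivAt (fun t : ℝ => fderiv ℝ ρ (p + t • w)) (fderiv ℝ (fderiv ℝ ρ) p w) 0 :=
      HasFDerivAt.comp_hasDerivAt (f := fun t : ℝ => p + t • w) 0 h2 (hline 0)
    exact (ContinuousLinearMap.apply ℝ ℝ w).hasFDerivAt.comp_hasDerivAt 0 h3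
  have hd3 : deriv (fun t : ℝ => ρ (p + t • w)) =ᶠ[𝓝 0] fun t => fderiv ℝ ρ (p + t • w) w :=
    hd1.mono fun t ht => ht.deriv
  have hpos : 0 < deriv (deriv fun t : ℝ => ρ (p + t • w)) 0 := by
    rw [hd3.deriv_eq, hd2.deriv]
    exact h.hessian_pos w hw hw0
  have hzero : deriv (fun t : ℝ => ρ (p + t • w)) 0 = 0 := by
    rw [hd3.self_of_nhds]
    simpa using hw0
  have hmin := isLocalMin_of_deriv_deriv_pos hpos hzero hd1.self_of_nhds.continuousAt
  have hsign := (eventually_nhdsWithin_sign_eq_of_deriv_pos hpos hzero).filter_mono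
    (nhdsWithin_le_nhds (s := Ioi 0))
  intro hle
  -- A local minimum with value `0`, together with `ρ ≤ 0`, forces `ρ` to vanish on a right
  -- neighbourhood. Its derivative then vanishes there too, whereas the positive second derivative
  -- makes it positive for small `t > 0`.
  have heq : ∀ᶠ t in 𝓝[>] (0 : ℝ), ρ (p + t • w) = 0 := by
    filter_upwards [hle, nhdsWithin_le_nhds hmin] with t h1 h2
    simp only [zero_smul, add_zero, h0] at h2
    exact le_antisymm h1 h2
  obtain ⟨t, ⟨h1, h2⟩, h3⟩ := (((eventually_eventually_nhdsWithin.2 heq).and hsign).and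
    self_mem_nhdsWithin).exists
  rw [isOpen_Ioi.nhdsWithin_eq h3] at h1
  have h4 : deriv (fun t : ℝ => ρ (p + t • w)) t = 0 := by
    rw [Filter.EventuallyEq.deriv_eq (f := fun _ => (0 : ℝ)) h1, deriv_const]
  rw [h4, sign_zero, sub_zero, sign_pos h3] at h2
  exact zero_ne_one h2

/-- A second point of the closure on the supporting hyperplane would give a tangent segment inside
the closure, on which `ρ ≤ 0` near `p`. -/
theorem eq_of_fderiv_apply_eq (h : IsDefiningAt D p ρ) (hD : IsOpen D)
    (hc : Convex ℝ D) (hp : p ∈ frontier D) {y : Eucl n} (hy : y ∈ closure D)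
    (he : fderiv ℝ ρ p y = fderiv ℝ ρ p p) : y = p := by
  by_contra hne
  have hw0 : fderiv ℝ ρ p (y - p) = 0 := by simp [he]
  have hcont : Filter.Tendsto (fun t : ℝ => p + t • (y - p)) (𝓝 0) (𝓝 p) := by
    have : Continuous (fun t : ℝ => p + t • (y - p)) := by fun_prop
    simpa using this.tendsto 0
  refine h.not_eventually_nonpos (h.apply_eq_zero hD hp) (sub_ne_zero.2 hne) hw0 ?_
  filter_upwards [nhdsWithin_le_nhds (hcont.eventually h.eventually_nonpos),
    self_mem_nhdsWithin, nhdsWithin_le_nhds (gt_mem_nhds (zero_lt_one' ℝ))] with t ht ht0 ht1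
  exact ht (hc.closure.add_smul_sub_mem (hD.frontier_eq ▸ hp).1 hy ⟨le_of_lt ht0, le_of_lt ht1⟩)

end IsDefiningAt

/-- Every boundary point of a strongly convex domain has a supporting functional which exposes
it. -/
theorem IsStronglyConvexDomain.exists_support (hD : IsStronglyConvexDomain D)
    (hp : p ∈ frontier D) : ∃ ℓ : Eucl n →L[ℝ] ℝ, (∀ y ∈ D, ℓ y < ℓ p) ∧
      (∀ y ∈ closure D, ℓ y ≤ ℓ p) ∧ ∀ y ∈ closure D, ℓ y = ℓ p → y = p := by
  obtain ⟨ρ, h⟩ := hD.exists_isDefiningAt hp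
  exact ⟨fderiv ℝ ρ p, fun y hy => h.fderiv_apply_lt hD.isOpen hD.convex hp hy,
    fun y hy => h.fderiv_apply_le_of_mem_closure hD.isOpen hD.convex hp hy,
    fun y hy he => h.eq_of_fderiv_apply_eq hD.isOpen hD.convex hp hy he⟩

end Support

/-! ### Calculus of constant-direction derivatives -/

section DirectionalDerivative

variable {V : Type*} [NormedAddCommGroup V] [NormedSpace ℝ V]

/-- The derivative of `f` in the constant direction `u`, as a function of the base point. -/
noncomputable def pd (u : V) (f : V → ℝ) (p : V) : ℝ := fderiv ℝ f p u

variable {Ω : Set V} {f g : V → ℝ} {p u w : V}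

theorem pd_add_dir : pd (u + w) f p = pd u f p + pd w f p := map_add _ _ _

theorem pd_smul_dir (c : ℝ) : pd (c • u) f p = c * pd u f p := by simp [pd]

theorem pd_neg_dir : pd (-u) f p = -pd u f p := map_neg _ _

theorem pd_sum_dir {ι : Type*} (s : Finset ι) (a : ι → V) :
    pd (∑ i ∈ s, a i) f p = ∑ i ∈ s, pd (a i) f p := map_sum _ _ _

theorem ContDiffOn.differentiableAt_of_mem (hf : ContDiffOn ℝ ∞ f Ω) (hΩ : IsOpen Ω)
    (hp : p ∈ Ω) : DifferentiableAt ℝ f p :=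
  (hf.contDiffAt (hΩ.mem_nhds hp)).differentiableAt (by simp)

theorem contDiffOn_pd (hf : ContDiffOn ℝ ∞ f Ω) (hΩ : IsOpen Ω) (u : V) :
    ContDiffOn ℝ ∞ (pd u f) Ω :=
  (hf.fderiv_of_isOpen hΩ (m := ∞) (by simp)).clm_apply contDiffOn_const

theorem pd_congr (h : EqOn f g Ω) (hΩ : IsOpen Ω) (hp : p ∈ Ω) : pd u f p = pd u g p := by
  rw [pd, pd, (h.eventuallyEq_of_mem (hΩ.mem_nhds hp)).fderiv_eq]

theorem pd_add (hΩ : IsOpen Ω) (hf : ContDiffOn ℝ ∞ f Ω) (hg : ContDiffOn ℝ ∞ g Ω) (hp : p ∈ Ω) :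
    pd u (fun q => f q + g q) p = pd u f p + pd u g p := by
  simp only [pd]
  rw [fderiv_fun_add (hf.differentiableAt_of_mem hΩ hp) (hg.differentiableAt_of_mem hΩ hp)]
  rfl

theorem pd_sub (hΩ : IsOpen Ω) (hf : ContDiffOn ℝ ∞ f Ω) (hg : ContDiffOn ℝ ∞ g Ω) (hp : p ∈ Ω) :
    pd u (fun q => f q - g q) p = pd u f p - pd u g p := by
  simp only [pd]
  rw [fderiv_fun_sub (hf.differentiableAt_of_mem hΩ hp) (hg.differentiableAt_of_mem hΩ hp)]
  rfl

theorem pd_mul (hΩ : IsOpen Ω) (hf : ContDiffOn ℝ ∞ f Ω) (hg : ContDiffOn ℝ ∞ g Ω) (hp : p ∈ Ω) :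
    pd u (fun q => f q * g q) p = pd u f p * g p + f p * pd u g p := by
  simp only [pd]
  rw [fderiv_fun_mul (hf.differentiableAt_of_mem hΩ hp) (hg.differentiableAt_of_mem hΩ hp)]
  simp
  ring

theorem pd_const_mul (hΩ : IsOpen Ω) (c : ℝ) (hf : ContDiffOn ℝ ∞ f Ω) (hp : p ∈ Ω) :
    pd u (fun q => c * f q) p = c * pd u f p := by
  rw [pd_mul hΩ contDiffOn_const hf hp]
  simp [pd]

theorem pd_sq (hΩ : IsOpen Ω) (hf : ContDiffOn ℝ ∞ f Ω) (hp : p ∈ Ω) :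
    pd u (fun q => f q ^ 2) p = 2 * f p * pd u f p := by
  simp only [pow_two]
  rw [pd_mul hΩ hf hf hp]
  ring

theorem pd_sum {ι : Type*} (hΩ : IsOpen Ω) (s : Finset ι) {f : ι → V → ℝ}
    (hf : ∀ i, ContDiffOn ℝ ∞ (f i) Ω) (hp : p ∈ Ω) :
    pd u (fun q => ∑ i ∈ s, f i q) p = ∑ i ∈ s, pd u (f i) p := by
  simp only [pd]
  rw [fderiv_fun_sum fun i _ => (hf i).differentiableAt_of_mem hΩ hp]
  simp

theorem pd_clm (L : V →L[ℝ] ℝ) : pd u (fun q => L q) p = L u := by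
  simp [pd]

theorem pd_comm (hΩ : IsOpen Ω) (hf : ContDiffOn ℝ ∞ f Ω) (hp : p ∈ Ω) :
    pd u (pd w f) p = pd w (pd u f) p := by
  have hfp := hf.contDiffAt (hΩ.mem_nhds hp)
  have hd : DifferentiableAt ℝ (fderiv ℝ f) p :=
    (hfp.fderiv_right (m := 1) (by norm_cast)).differentiableAt one_ne_zero
  have key (a b : V) : pd a (pd b f) p = fderiv ℝ (fderiv ℝ f) p a b := by
    have h3 : HasFDerivAt (fun q => fderiv ℝ f q b)
        ((ContinuousLinearMap.apply ℝ ℝ b).comp (fderiv ℝ (fderiv ℝ f) p)) p :=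
      (ContinuousLinearMap.apply ℝ ℝ b).hasFDerivAt.comp p hd.hasFDerivAt
    change fderiv ℝ (fun q => fderiv ℝ f q b) p a = _
    rw [h3.fderiv]
    rfl
  rw [key, key]
  exact (hfp.isSymmSndFDerivAt (by simp; norm_cast)) u w

theorem hasDerivAt_line (p u : V) (s : ℝ) : HasDerivAt (fun t : ℝ => p + t • u) u s := by
  simpa using ((hasDerivAt_id s).smul_const u).const_add p

theorem hasDerivAt_comp_line (hΩ : IsOpen Ω) (hf : ContDiffOn ℝ ∞ f Ω) {s : ℝ}
    (hp : p + s • u ∈ Ω) : HasDerivAt (fun t : ℝ => f (p + t • u)) (pd u f (p + s • u)) s :=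
  HasFDerivAt.comp_hasDerivAt (f := fun t : ℝ => p + t • u) s
    (hf.differentiableAt_of_mem hΩ hp).hasFDerivAt (hasDerivAt_line p u s)

end DirectionalDerivative

/-! ### Coordinate partial derivatives as directional derivatives -/

section PartialDerivatives

variable {n : ℕ} {Ω : Set (Eucl n × Eucl n)} {f : Eucl n → Eucl n → ℝ} {x v : Eucl n}

/-- The `k`-th coordinate direction of the base. -/
noncomputable def dirX {n : ℕ} (k : Fin n) : Eucl n × Eucl n := (EuclideanSpace.single k 1, 0)

/-- The `k`-th coordinate direction of the fibre. -/
noncomputable def dirV {n : ℕ} (k : Fin n) : Eucl n × Eucl n := (0, EuclideanSpace.single k 1)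

theorem partialX_eq_pd (hΩ : IsOpen Ω) (hf : ContDiffOn ℝ ∞ (fun q : Eucl n × Eucl n => f q.1 q.2) Ω)
    (h : (x, v) ∈ Ω) (k : Fin n) : partialX k f x v = pd (dirX k) (fun q => f q.1 q.2) (x, v) := by
  have := hasDerivAt_comp_line (p := (x, v)) (u := dirX k) (s := 0) hΩ hf (by simpa using h)
  rw [partialX, HasLineDerivAt.lineDeriv]
  simpa [dirX, HasLineDerivAt] using this

theorem partialV_eq_pd (hΩ : IsOpen Ω) (hf : ContDiffOn ℝ ∞ (fun q : Eucl n × Eucl n => f q.1 q.2) Ω)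
    (h : (x, v) ∈ Ω) (k : Fin n) : partialV k f x v = pd (dirV k) (fun q => f q.1 q.2) (x, v) := by
  have := hasDerivAt_comp_line (p := (x, v)) (u := dirV k) (s := 0) hΩ hf (by simpa using h)
  rw [partialV, HasLineDerivAt.lineDeriv]
  simpa [dirV, HasLineDerivAt] using this

theorem sum_smul_dirV (w : Eucl n) : ∑ k, w k • dirV k = (0, w) := by
  have h := (EuclideanSpace.basisFun (Fin n) ℝ).sum_repr w
  simp only [EuclideanSpace.basisFun_repr, EuclideanSpace.basisFun_apply] at h
  ext : 1
  · simp [dirV, Prod.fst_sum]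
  · simp [dirV, Prod.snd_sum, h]

theorem sum_smul_dirX (w : Eucl n) : ∑ k, w k • dirX k = (w, 0) := by
  have h := (EuclideanSpace.basisFun (Fin n) ℝ).sum_repr w
  simp only [EuclideanSpace.basisFun_repr, EuclideanSpace.basisFun_apply] at h
  ext : 1
  · simp [dirX, Prod.fst_sum, h]
  · simp [dirX, Prod.snd_sum]

theorem sum_mul_pd_dirV (w : Eucl n) (g : Eucl n × Eucl n → ℝ) (p : Eucl n × Eucl n) :
    ∑ k, w k * pd (dirV k) g p = pd (0, w) g p := by
  simp only [← sum_smul_dirV, pd_sum_dir, pd_smul_dir]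

theorem sum_mul_pd_dirX (w : Eucl n) (g : Eucl n × Eucl n → ℝ) (p : Eucl n × Eucl n) :
    ∑ k, w k * pd (dirX k) g p = pd (w, 0) g p := by
  simp only [← sum_smul_dirX, pd_sum_dir, pd_smul_dir]

end PartialDerivatives

/-! ### Smoothness of the exit time -/

section Funk

variable {n : ℕ} {D : Set (Eucl n)} {x v w p : Eucl n}

/-- The points `p + t w` with small `t < 0` have `ρ < 0`, so they lie in `D` and converge to `p`.
This recognizes a zero of `ρ` found by the implicit function theorem as a boundary point. -/
theorem IsDefiningAt.mem_frontier {ρ : Eucl n → ℝ} (hD : IsOpen D)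
    (hm : ∀ᶠ z in 𝓝 p, z ∈ D ↔ ρ z < 0) (h0 : ρ p = 0) (hd : DifferentiableAt ℝ ρ p)
    (hw : 0 < fderiv ℝ ρ p w) : p ∈ frontier D := by
  rw [hD.frontier_eq]
  refine ⟨?_, fun h => ?_⟩
  · have hder : HasDerivAt (fun t : ℝ => ρ (p + t • w)) (fderiv ℝ ρ p w) 0 :=
      hd.hasFDerivAt.hasLineDerivAt w
    have hcont : Filter.Tendsto (fun t : ℝ => p + t • w) (𝓝 0) (𝓝 p) := by
      simpa using (hasDerivAt_line p w 0).continuousAt.tendsto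
    have hs := eventually_nhdsWithin_sign_eq_of_deriv_pos (by rwa [hder.deriv]) (by simpa using h0)
    have hlt : ∀ᶠ t in 𝓝[<] (0 : ℝ), p + t • w ∈ D := by
      filter_upwards [nhdsWithin_le_nhds hs, nhdsWithin_le_nhds (hcont.eventually hm),
        self_mem_nhdsWithin] with t h1 h2 h3
      have h3 : t < 0 := h3
      rw [sub_zero, sign_neg h3, sign_eq_neg_one_iff] at h1
      exact h2.2 h1
    exact mem_closure_of_tendsto (hcont.mono_left nhdsWithin_le_nhds) hlt
  · exact absurd (hm.self_of_nhds.1 h) (by simp [h0])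

/-- The ray crosses the boundary transversally: `x` is strictly inside the supporting half-space at
the exit point, and the two points differ by a positive multiple of `v`. -/
theorem fderiv_defining_pos {ρ : Eucl n → ℝ} (hD : IsStronglyConvexDomain D) (hx : x ∈ D)
    (hv : v ≠ 0) (hρ : IsDefiningAt D (boundaryPoint D x v) ρ) :
    0 < fderiv ℝ ρ (boundaryPoint D x v) v := by
  have h := hρ.fderiv_apply_lt hD.isOpen hD.convex (boundaryPoint_mem_frontier hD hx hv) hx
  nth_rw 3 [boundaryPoint] at h
  rw [map_add, map_smul, smul_eq_mul] at h
  have h' : 0 < boundaryTime D x v * fderiv ℝ ρ (boundaryPoint D x v) v := by linarith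
  exact (pos_iff_pos_of_mul_pos h').1 (boundaryTime_pos hD hx hv)

/-- The equation `ρ (x + t v) = 0` has the `t`-derivative `dρ(v) > 0` at the exit point, so it has a
smooth local solution `t = ψ (x, v)`. Nearby, the point with parameter `ψ` is a frontier point with
positive parameter, and the ray meets the frontier only once. -/
theorem contDiffAt_boundaryTime (hD : IsStronglyConvexDomain D) (hx : x ∈ D) (hv : v ≠ 0) :
    ContDiffAt ℝ ∞ (fun q : Eucl n × Eucl n => boundaryTime D q.1 q.2) (x, v) := by
  obtain ⟨ρ, hρ⟩ := hD.exists_isDefiningAt (boundaryPoint_mem_frontier hD hx hv)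
  have hpos := fderiv_defining_pos hD hx hv hρ
  have h0 := hρ.apply_eq_zero hD.isOpen (boundaryPoint_mem_frontier hD hx hv)
  set T := boundaryTime D x v with hT
  have hTpos : 0 < T := boundaryTime_pos hD hx hv
  have hb : boundaryPoint D x v = x + T • v := rfl
  rw [hb] at hρ hpos h0
  let e : (Eucl n × Eucl n) × ℝ → Eucl n := fun u => u.1.1 + u.2 • u.1.2
  have he : ContDiff ℝ ∞ e := by fun_prop
  have hf : ContDiffAt ℝ ∞ (fun u => ρ (e u)) ((x, v), T) :=
    ContDiffAt.comp ((x, v), T) (g := ρ) (f := e) hρ.contDiffAt he.contDiffAt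
  have hinr : ∀ t : ℝ, (fderiv ℝ (fun u => ρ (e u)) ((x, v), T) ∘L .inr ℝ (Eucl n × Eucl n) ℝ) t
      = t * fderiv ℝ ρ (x + T • v) v := by
    intro t
    have h1 : HasFDerivAt e (fderiv ℝ e ((x, v), T)) ((x, v), T) :=
      (he.differentiable (by simp)).differentiableAt.hasFDerivAt
    have h2 : HasFDerivAt (fun u => ρ (e u))
      ((fderiv ℝ ρ (x + T • v)).comp (fderiv ℝ e ((x, v), T))) ((x, v), T) :=
      HasFDerivAt.comp (g := ρ) ((x, v), T) hρ.hasFDerivAt h1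
    have h3 : HasDerivAt (fun s : ℝ => e (((x, v), T) + s • ((0 : Eucl n × Eucl n), (1 : ℝ))))
        (fderiv ℝ e ((x, v), T) (0, 1)) 0 := h1.hasLineDerivAt _
    have h4 : HasDerivAt (fun s : ℝ => (x + T • v) + s • v) v 0 := hasDerivAt_line _ _ _
    have h5 : fderiv ℝ e ((x, v), T) (0, 1) = v := by
      refine h3.unique (h4.congr_of_eventuallyEq (Filter.Eventually.of_forall fun s => ?_))
      simp [e, add_smul, add_assoc]
    rw [h2.fderiv]
    have : ((0, t) : (Eucl n × Eucl n) × ℝ) = t • ((0, 1) : (Eucl n × Eucl n) × ℝ) := by simp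
    simp only [ContinuousLinearMap.comp_apply, ContinuousLinearMap.inr_apply]
    rw [this, map_smul, h5, map_smul, smul_eq_mul]
  have hinv : (fderiv ℝ (fun u => ρ (e u)) ((x, v), T) ∘L
      .inr ℝ (Eucl n × Eucl n) ℝ).IsInvertible := by
    refine ⟨ContinuousLinearEquiv.unitsEquivAut ℝ (Units.mk0 _ hpos.ne'), ?_⟩
    ext
    simp only [hinr]
    simp
  set ψ := hf.implicitFunction (by simp) hinv with hψ
  have hψs : ContDiffAt ℝ ∞ ψ (x, v) := hf.contDiffAt_implicitFunction (by simp) hinv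
  have hψ0 : ψ (x, v) = T := hf.implicitFunction_apply_self (by simp) hinv
  have hψe : ∀ᶠ q in 𝓝 (x, v), ρ (e (q, ψ q)) = 0 := by
    filter_upwards [hf.eventually_apply_implicitFunction (by simp) hinv] with q hq
    exact hq.trans h0
  have hcont : ContinuousAt (fun q => e (q, ψ q)) (x, v) :=
    ContinuousAt.comp (g := e) he.continuous.continuousAt
      (continuousAt_id.prodMk hψs.continuousAt)
  have hp0 : e ((x, v), ψ (x, v)) = x + T • v := by rw [hψ0]
  refine hψs.congr_of_eventuallyEq ?_
  have e1 : ∀ᶠ q in 𝓝 (x, v), 0 < ψ q :=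
    hψs.continuousAt.eventually (lt_mem_nhds (by rwa [hψ0]))
  have e2 : ∀ᶠ q : Eucl n × Eucl n in 𝓝 (x, v), q.1 ∈ D :=
    continuousAt_fst.eventually (hD.isOpen.mem_nhds hx)
  have hdiff : ∀ᶠ y in 𝓝 (x + T • v), DifferentiableAt ℝ ρ y := by
    have := (hρ.contDiffAt.of_le (m := 1) (by norm_cast)).eventually (by simp)
    filter_upwards [this] with y hy using hy.differentiableAt (by simp)
  have hcd : ContinuousAt (fun q : Eucl n × Eucl n => fderiv ℝ ρ (e (q, ψ q)) q.2) (x, v) := by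
    refine ContinuousAt.clm_apply ?_ continuousAt_snd
    refine ContinuousAt.comp (g := fderiv ℝ ρ) (f := fun q => e (q, ψ q)) ?_ hcont
    rw [hp0]
    exact (hρ.contDiffAt.fderiv_right (m := 1) (by norm_cast)).continuousAt
  have e3 : ∀ᶠ q : Eucl n × Eucl n in 𝓝 (x, v), 0 < fderiv ℝ ρ (e (q, ψ q)) q.2 :=
    hcd.eventually (lt_mem_nhds (by
      change 0 < fderiv ℝ ρ (e ((x, v), ψ (x, v))) v
      rwa [hp0]))
  have hcont' : Filter.Tendsto (fun q => e (q, ψ q)) (𝓝 (x, v)) (𝓝 (x + T • v)) := by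
    rw [← hp0]; exact hcont
  filter_upwards [e1, e2, e3, hψe, hcont'.eventually hdiff,
    hcont'.eventually hρ.mem_iff.eventually_nhds] with q h1 h2 h3 h4 h5 h6
  exact boundaryTime_eq_of_mem_frontier hD h2 h1
    (IsDefiningAt.mem_frontier hD.isOpen h6 h4 h5 h3)

end Funk

/-- The nonzero tangent vectors at points of `D`. -/
def slitTangent {n : ℕ} (D : Set (Eucl n)) : Set (Eucl n × Eucl n) := D ×ˢ {v | v ≠ 0}

/-- The Funk metric `k(x, v)` of `D`, the reciprocal of the time at which the ray `x + t v` leaves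
`D`. -/
noncomputable def funk {n : ℕ} (D : Set (Eucl n)) (q : Eucl n × Eucl n) : ℝ :=
  (boundaryTime D q.1 q.2)⁻¹

/-- The reverse Funk metric `k(x, -v)` of `D`. -/
noncomputable def revFunk {n : ℕ} (D : Set (Eucl n)) (q : Eucl n × Eucl n) : ℝ :=
  (boundaryTime D q.1 (-q.2))⁻¹

/-! ### Okada's equation and Euler's identity -/

section FunkCalculus

variable {n : ℕ} {D : Set (Eucl n)} {x v w : Eucl n}

theorem mem_slitTangent {q : Eucl n × Eucl n} : q ∈ slitTangent D ↔ q.1 ∈ D ∧ q.2 ≠ 0 := by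
  simp [slitTangent]

theorem isOpen_slitTangent (hD : IsOpen D) : IsOpen (slitTangent D) :=
  hD.prod isOpen_ne

theorem contDiffOn_boundaryTime (hD : IsStronglyConvexDomain D) :
    ContDiffOn ℝ ∞ (fun q : Eucl n × Eucl n => boundaryTime D q.1 q.2) (slitTangent D) :=
  fun _ hq => (contDiffAt_boundaryTime hD hq.1 hq.2).contDiffWithinAt

theorem contDiffOn_funk (hD : IsStronglyConvexDomain D) :
    ContDiffOn ℝ ∞ (funk D) (slitTangent D) :=
  (contDiffOn_boundaryTime hD).inv fun _ hq => (boundaryTime_pos hD hq.1 hq.2).ne'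

theorem contDiffOn_revFunk (hD : IsStronglyConvexDomain D) :
    ContDiffOn ℝ ∞ (revFunk D) (slitTangent D) := by
  have hn : ContDiffOn ℝ ∞ (fun q : Eucl n × Eucl n => (q.1, -q.2)) (slitTangent D) :=
    (contDiff_fst.prodMk contDiff_snd.neg).contDiffOn
  have hm : MapsTo (fun q : Eucl n × Eucl n => (q.1, -q.2)) (slitTangent D) (slitTangent D) := by
    intro q hq
    rw [mem_slitTangent] at hq ⊢
    exact ⟨hq.1, neg_ne_zero.2 hq.2⟩
  have h : revFunk D = funk D ∘ fun q : Eucl n × Eucl n => (q.1, -q.2) := by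
    ext q
    simp only [revFunk, funk, Function.comp_apply]
  rw [h]
  exact (contDiffOn_funk hD).comp hn hm

theorem funk_pos (hD : IsStronglyConvexDomain D) (hx : x ∈ D) (hv : v ≠ 0) : 0 < funk D (x, v) :=
  inv_pos.2 (boundaryTime_pos hD hx hv)

theorem revFunk_pos (hD : IsStronglyConvexDomain D) (hx : x ∈ D) (hv : v ≠ 0) :
    0 < revFunk D (x, v) :=
  inv_pos.2 (boundaryTime_pos hD hx (neg_ne_zero.2 hv))

theorem funk_smul (hD : IsStronglyConvexDomain D) (hx : x ∈ D) {c : ℝ} (hc : 0 ≤ c) :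
    funk D (x, c • v) = c * funk D (x, v) := by
  simp only [funk]
  rw [boundaryTime_smul hD hx hc, mul_inv, inv_inv]

theorem revFunk_smul (hD : IsStronglyConvexDomain D) (hx : x ∈ D) {c : ℝ} (hc : 0 ≤ c) :
    revFunk D (x, c • v) = c * revFunk D (x, v) := by
  simp only [revFunk]
  rw [← smul_neg, boundaryTime_smul hD hx hc, mul_inv, inv_inv]

/-- Since `T k = 1`, one has `(x + s w) + T (v - s k w) = x + T v`: the new ray reaches the same
boundary point at the same time. Differentiation in `s` gives Okada's equation. -/
theorem funk_add_smul_eq (hD : IsStronglyConvexDomain D) (hx : x ∈ D) (hv : v ≠ 0) (w : Eucl n) :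
    ∀ᶠ s in 𝓝 (0 : ℝ), funk D ((x, v) + s • (w, -funk D (x, v) • w)) = funk D (x, v) := by
  have hT := boundaryTime_pos hD hx hv
  have hc : Filter.Tendsto (fun s : ℝ => x + s • w) (𝓝 0) (𝓝 x) := by
    simpa using (hasDerivAt_line x w 0).continuousAt.tendsto
  filter_upwards [hc.eventually (hD.isOpen.mem_nhds hx)] with s hs
  have hb : boundaryPoint D x v ∈ frontier D := boundaryPoint_mem_frontier hD hx hv
  have : x + s • w + boundaryTime D x v • (v + s • (-funk D (x, v) • w)) =
      boundaryPoint D x v := by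
    rw [boundaryPoint, smul_add, smul_smul, smul_smul, funk]
    have : boundaryTime D x v * s * -(boundaryTime D x v)⁻¹ = -s := by field_simp
    rw [this]
    module
  rw [← this] at hb
  have := boundaryTime_eq_of_mem_frontier hD hs hT hb
  simp only [funk, Prod.mk_add_mk, Prod.smul_mk] at this ⊢
  rw [this]

/-- Okada's equation for the Funk metric. -/
theorem pd_funk_base (hD : IsStronglyConvexDomain D) (hx : x ∈ D) (hv : v ≠ 0) (w : Eucl n) :
    pd (w, 0) (funk D) (x, v) = funk D (x, v) * pd (0, w) (funk D) (x, v) := by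
  have h1 := hasDerivAt_comp_line (p := (x, v)) (u := (w, -funk D (x, v) • w)) (s := 0)
    (isOpen_slitTangent hD.isOpen) (contDiffOn_funk hD) (by simpa using ⟨hx, hv⟩)
  have h2 : HasDerivAt (fun s : ℝ => funk D ((x, v) + s • (w, -funk D (x, v) • w))) 0 0 :=
    (hasDerivAt_const (0 : ℝ) (funk D (x, v))).congr_of_eventuallyEq (funk_add_smul_eq hD hx hv w)
  have h3 := h1.unique h2
  have h4 : ((w, -funk D (x, v) • w) : Eucl n × Eucl n) = (w, 0) + (-funk D (x, v)) • (0, w) := by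
    simp
  rw [zero_smul, add_zero, h4, pd_add_dir, pd_smul_dir] at h3
  linarith

theorem pd_revFunk (hD : IsStronglyConvexDomain D) (hx : x ∈ D) (hv : v ≠ 0)
    (u : Eucl n × Eucl n) :
    pd u (revFunk D) (x, v) = pd (u.1, -u.2) (funk D) (x, -v) := by
  have h1 := hasDerivAt_comp_line (p := (x, v)) (u := u) (s := 0)
    (isOpen_slitTangent hD.isOpen) (contDiffOn_revFunk hD) (by simpa using ⟨hx, hv⟩)
  have h2 := hasDerivAt_comp_line (p := (x, -v)) (u := (u.1, -u.2)) (s := 0)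
    (isOpen_slitTangent hD.isOpen) (contDiffOn_funk hD) (by simpa using ⟨hx, neg_ne_zero.2 hv⟩)
  have : (fun s : ℝ => revFunk D ((x, v) + s • u)) =
      fun s : ℝ => funk D ((x, -v) + s • (u.1, -u.2)) := by
    ext s
    simp [funk, revFunk, add_comm]
  rw [this] at h1
  simpa using h1.unique h2

/-- Reversing `v` preserves base derivatives and changes the sign of fibre derivatives, which
accounts for the minus sign. -/
theorem pd_revFunk_base (hD : IsStronglyConvexDomain D) (hx : x ∈ D) (hv : v ≠ 0) (w : Eucl n) :
    pd (w, 0) (revFunk D) (x, v) = -revFunk D (x, v) * pd (0, w) (revFunk D) (x, v) := by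
  rw [pd_revFunk hD hx hv, pd_revFunk hD hx hv]
  simp only [neg_zero]
  rw [pd_funk_base hD hx (neg_ne_zero.2 hv), show ((0, -w) : Eucl n × Eucl n) = -(0, w) by simp,
    pd_neg_dir]
  simp [funk, revFunk]

/-- Euler's identity for functions which are positively homogeneous of degree one. -/
theorem pd_euler {f : Eucl n × Eucl n → ℝ} (hD : IsOpen D)
    (hf : ContDiffOn ℝ ∞ f (slitTangent D)) (hx : x ∈ D) (hv : v ≠ 0)
    (h : ∀ c : ℝ, 0 < c → f (x, c • v) = c * f (x, v)) : pd (0, v) f (x, v) = f (x, v) := by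
  have h1 := hasDerivAt_comp_line (p := (x, v)) (u := (0, v)) (s := 0)
    (isOpen_slitTangent hD) hf (by simpa using ⟨hx, hv⟩)
  have h2 : HasDerivAt (fun s : ℝ => (1 + s) * f (x, v)) (f (x, v)) 0 := by
    simpa using ((hasDerivAt_id (0 : ℝ)).const_add 1).mul_const (f (x, v))
  rw [zero_smul, add_zero] at h1
  refine h1.unique (h2.congr_of_eventuallyEq ?_)
  filter_upwards [lt_mem_nhds (show (-1 : ℝ) < 0 by norm_num)] with s hs
  rw [← h (1 + s) (by linarith)]
  simp [add_smul]

theorem pd_funk_radial (hD : IsStronglyConvexDomain D) (hx : x ∈ D) (hv : v ≠ 0) :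
    pd (0, v) (funk D) (x, v) = funk D (x, v) :=
  pd_euler hD.isOpen (contDiffOn_funk hD) hx hv fun _ hc => funk_smul hD hx hc.le

theorem pd_revFunk_radial (hD : IsStronglyConvexDomain D) (hx : x ∈ D) (hv : v ≠ 0) :
    pd (0, v) (revFunk D) (x, v) = revFunk D (x, v) :=
  pd_euler hD.isOpen (contDiffOn_revFunk hD) hx hv fun _ hc => revFunk_smul hD hx hc.le

end FunkCalculus

/-! ### Positivity of the vertical Hessian of the Funk metric -/

section FunkHessian

variable {n : ℕ} {D : Set (Eucl n)} {Ω : Set (Eucl n × Eucl n)} {f : Eucl n × Eucl n → ℝ}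
  {x v w : Eucl n}

theorem contDiffOn_coord (k : Fin n) : ContDiffOn ℝ ∞ (fun q : Eucl n × Eucl n => q.2 k) Ω :=
  (((EuclideanSpace.proj k : Eucl n →L[ℝ] ℝ).comp
    (ContinuousLinearMap.snd ℝ (Eucl n) (Eucl n))).contDiff).contDiffOn

theorem pd_coord (k : Fin n) (u p : Eucl n × Eucl n) :
    pd u (fun q : Eucl n × Eucl n => q.2 k) p = u.2 k :=
  pd_clm ((EuclideanSpace.proj k : Eucl n →L[ℝ] ℝ).comp
    (ContinuousLinearMap.snd ℝ (Eucl n) (Eucl n)))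

theorem hasDerivAt_fibre_line (hΩ : IsOpen Ω) (hf : ContDiffOn ℝ ∞ f Ω) {s : ℝ}
    (hp : (x, v + s • w) ∈ Ω) :
    HasDerivAt (fun t : ℝ => f (x, v + t • w)) (pd (0, w) f (x, v + s • w)) s := by
  have := hasDerivAt_comp_line (p := (x, v)) (u := (0, w)) (s := s) hΩ hf (by simpa using hp)
  simpa using this

theorem hasDerivAt_base_line (hΩ : IsOpen Ω) (hf : ContDiffOn ℝ ∞ f Ω) {s : ℝ}
    (hp : (x + s • w, v) ∈ Ω) :
    HasDerivAt (fun t : ℝ => f (x + t • w, v)) (pd (w, 0) f (x + s • w, v)) s := by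
  have := hasDerivAt_comp_line (p := (x, v)) (u := (w, 0)) (s := s) hΩ hf (by simpa using hp)
  simpa using this

/-- The derivative of Euler's identity for a function which is homogeneous of degree `r`. -/
theorem pd_radial_pd_of_homogeneous (hΩ : IsOpen Ω) (hf : ContDiffOn ℝ ∞ f Ω) {r : ℝ}
    (hE : ∀ q ∈ Ω, pd (0, q.2) f q = r * f q) (h : (x, v) ∈ Ω) (u : Eucl n × Eucl n) :
    pd (0, v) (pd u f) (x, v) = r * pd u f (x, v) - pd (0, u.2) f (x, v) := by
  -- In Euler's identity the direction varies with the point. Expanded in coordinates it involves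
  -- only constant directions, and the product rule applies.
  have h1 : EqOn (fun q => ∑ k, q.2 k * pd (dirV k) f q) (fun q => r * f q) Ω := fun q hq => by
    change ∑ k, q.2 k * pd (dirV k) f q = r * f q
    rw [sum_mul_pd_dirV, hE q hq]
  have h2 := pd_congr (u := u) h1 hΩ h
  rw [pd_sum hΩ Finset.univ (f := fun k q => q.2 k * pd (dirV k) f q)
    (fun k => (contDiffOn_coord k).mul (contDiffOn_pd hf hΩ _)) h, pd_const_mul hΩ _ hf h] at h2
  have h3 : ∀ k, pd u (fun q : Eucl n × Eucl n => q.2 k * pd (dirV k) f q) (x, v) =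
      u.2 k * pd (dirV k) f (x, v) + v k * pd (dirV k) (pd u f) (x, v) := fun k => by
    rw [pd_mul hΩ (contDiffOn_coord k) (contDiffOn_pd hf hΩ _) h, pd_coord, pd_comm hΩ hf h]
  rw [Finset.sum_congr rfl fun k _ => h3 k, Finset.sum_add_distrib, sum_mul_pd_dirV,
    sum_mul_pd_dirV] at h2
  linarith

theorem pd_radial_pd (hΩ : IsOpen Ω) (hf : ContDiffOn ℝ ∞ f Ω)
    (hE : ∀ q ∈ Ω, pd (0, q.2) f q = f q) (h : (x, v) ∈ Ω) (u : Eucl n × Eucl n) :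
    pd (0, v) (pd u f) (x, v) = pd u f (x, v) - pd (0, u.2) f (x, v) := by
  rw [pd_radial_pd_of_homogeneous hΩ hf (r := 1) (fun q hq => by rw [hE q hq, one_mul]) h, one_mul]

theorem pd_radial_pd_fibre (hΩ : IsOpen Ω) (hf : ContDiffOn ℝ ∞ f Ω)
    (hE : ∀ q ∈ Ω, pd (0, q.2) f q = f q) (h : (x, v) ∈ Ω) (w : Eucl n) :
    pd (0, v) (pd (0, w) f) (x, v) = 0 := by
  rw [pd_radial_pd hΩ hf hE h, sub_self]

/-- Let `τ` be the exit time along `v + s w`. Differentiating `ρ (x + τ (v + s w)) = 0` twice at `s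
= 0`, where `τ' = 0`, gives `T² Hess ρ (w, w) + τ'' dρ(v) = 0`. The first derivative shows that `w`
is tangent to the boundary, so the Hessian term is positive; `dρ(v)` is positive by transversality.
-/
theorem pd_pd_boundaryTime_neg (hD : IsStronglyConvexDomain D) (hx : x ∈ D) (hv : v ≠ 0)
    (hw : w ≠ 0)
    (h : pd (0, w) (fun q : Eucl n × Eucl n => boundaryTime D q.1 q.2) (x, v) = 0) :
    pd (0, w) (pd (0, w) fun q : Eucl n × Eucl n => boundaryTime D q.1 q.2) (x, v) < 0 := by
  have hΩ := isOpen_slitTangent hD.isOpen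
  have hτ := contDiffOn_boundaryTime hD
  set τ : Eucl n × Eucl n → ℝ := fun q => boundaryTime D q.1 q.2 with hτdef
  have hT : 0 < τ (x, v) := boundaryTime_pos hD hx hv
  obtain ⟨ρ, hρ⟩ := hD.exists_isDefiningAt (boundaryPoint_mem_frontier hD hx hv)
  have hpos := fderiv_defining_pos hD hx hv hρ
  have hb : boundaryPoint D x v = x + τ (x, v) • v := rfl
  rw [hb] at hρ hpos
  have hline (t : ℝ) := hasDerivAt_line v w t
  have hne : ∀ᶠ s in 𝓝 (0 : ℝ), v + s • w ≠ 0 := by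
    have : Filter.Tendsto (fun s : ℝ => v + s • w) (𝓝 0) (𝓝 v) := by
      simpa using (hline 0).continuousAt.tendsto
    exact this.eventually (isOpen_ne.mem_nhds hv)
  have hmem {s : ℝ} (hs : v + s • w ≠ 0) : (x, v + s • w) ∈ slitTangent D :=
    mem_slitTangent.2 ⟨hx, hs⟩
  have hτ1 : ∀ᶠ s in 𝓝 (0 : ℝ), HasDerivAt (fun t : ℝ => τ (x, v + t • w))
      (pd (0, w) τ (x, v + s • w)) s :=
    hne.mono fun s hs => hasDerivAt_fibre_line hΩ hτ (hmem hs)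
  have hτ2 : HasDerivAt (fun t : ℝ => pd (0, w) τ (x, v + t • w))
      (pd (0, w) (pd (0, w) τ) (x, v)) 0 := by
    have := hasDerivAt_fibre_line (s := 0) hΩ (contDiffOn_pd hτ hΩ (0, w)) (hmem hne.self_of_nhds)
    simpa using this
  set c : ℝ → Eucl n := fun s => x + τ (x, v + s • w) • (v + s • w) with hc
  set c' : ℝ → Eucl n := fun s =>
    τ (x, v + s • w) • w + pd (0, w) τ (x, v + s • w) • (v + s • w) with hc'
  have hc0 : c 0 = x + τ (x, v) • v := by simp [hc]
  have hc'0 : c' 0 = τ (x, v) • w := by simp [hc', h]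
  have hcd : ∀ᶠ s in 𝓝 (0 : ℝ), HasDerivAt c (c' s) s :=
    hτ1.mono fun s hs => (hs.smul (hline s)).const_add x
  have hcd' : HasDerivAt c' (pd (0, w) (pd (0, w) τ) (x, v) • v) 0 := by
    have h1 : HasDerivAt c' (pd (0, w) τ (x, v + (0 : ℝ) • w) • w +
        (pd (0, w) τ (x, v + (0 : ℝ) • w) • w + pd (0, w) (pd (0, w) τ) (x, v) •
          (v + (0 : ℝ) • w))) 0 :=
      (hτ1.self_of_nhds.smul_const w).add (hτ2.smul (hline 0))
    convert h1 using 1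
    simp [h]
  have hcc : Filter.Tendsto c (𝓝 0) (𝓝 (x + τ (x, v) • v)) := by
    rw [← hc0]; exact hcd.self_of_nhds.continuousAt
  have hdiff : ∀ᶠ y in 𝓝 (x + τ (x, v) • v), DifferentiableAt ℝ ρ y := by
    have := (hρ.contDiffAt.of_le (m := 1) (by norm_cast)).eventually (by simp)
    filter_upwards [this] with y hy using hy.differentiableAt (by simp)
  have hzero : ∀ᶠ s in 𝓝 (0 : ℝ), ρ (c s) = 0 := by
    filter_upwards [hne, hcc.eventually hρ.mem_iff, hcc.eventually hρ.eventually_nonpos]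
      with s hs h1 h2
    have hfr : c s ∈ frontier D := boundaryPoint_mem_frontier hD hx hs
    rw [hD.isOpen.frontier_eq] at hfr
    exact le_antisymm (h2 hfr.1) (not_lt.1 fun h' => hfr.2 (h1.2 h'))
  have hg : ∀ᶠ s in 𝓝 (0 : ℝ), fderiv ℝ ρ (c s) (c' s) = 0 := by
    filter_upwards [hzero.eventually_nhds, hcd, hcc.eventually hdiff] with s h1 h2 h3
    have h4 : HasDerivAt (fun t => ρ (c t)) (fderiv ℝ ρ (c s) (c' s)) s :=
      h3.hasFDerivAt.comp_hasDerivAt s h2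
    exact h4.unique ((hasDerivAt_const s (0 : ℝ)).congr_of_eventuallyEq h1)
  have h1 : ContDiffAt ℝ 1 (fderiv ℝ ρ) (x + τ (x, v) • v) :=
    hρ.contDiffAt.fderiv_right (by norm_cast)
  have h2 : HasFDerivAt (fderiv ℝ ρ) (fderiv ℝ (fderiv ℝ ρ) (c 0)) (c 0) := by
    rw [hc0]
    exact (h1.differentiableAt one_ne_zero).hasFDerivAt
  have h3 : HasDerivAt (fun s : ℝ => fderiv ℝ ρ (c s)) (fderiv ℝ (fderiv ℝ ρ) (c 0) (c' 0)) 0 :=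
    HasFDerivAt.comp_hasDerivAt (f := c) 0 h2 hcd.self_of_nhds
  have h4 := h3.clm_apply hcd'
  have h5 := h4.unique ((hasDerivAt_const (0 : ℝ) (0 : ℝ)).congr_of_eventuallyEq hg)
  have h6 := hg.self_of_nhds
  rw [hc0, hc'0, map_smul, smul_eq_mul] at h6
  have h7 := hρ.hessian_pos w hw ((mul_eq_zero.1 h6).resolve_left hT.ne')
  rw [hc0, hc'0] at h5
  simp only [map_smul, smul_eq_mul, smul_apply] at h5
  by_contra! hcon
  nlinarith [mul_pos hT (mul_pos hT h7), mul_nonneg hcon hpos.le]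

/-- Differentiating `k τ = 1` twice at a critical direction leaves `k'' τ + k τ'' = 0`. -/
theorem pd_pd_funk_pos_of_pd_eq_zero (hD : IsStronglyConvexDomain D) (hx : x ∈ D) (hv : v ≠ 0)
    (hw : w ≠ 0) (h : pd (0, w) (funk D) (x, v) = 0) :
    0 < pd (0, w) (pd (0, w) (funk D)) (x, v) := by
  have hΩ := isOpen_slitTangent hD.isOpen
  have hτ := contDiffOn_boundaryTime hD
  have hk := contDiffOn_funk hD
  have hp : (x, v) ∈ slitTangent D := mem_slitTangent.2 ⟨hx, hv⟩
  have hneg := pd_pd_boundaryTime_neg hD hx hv hw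
  have hT : 0 < boundaryTime D x v := boundaryTime_pos hD hx hv
  have hone : EqOn (fun q => funk D q * boundaryTime D q.1 q.2) (fun _ => 1) (slitTangent D) := by
    intro q hq
    rw [mem_slitTangent] at hq
    exact inv_mul_cancel₀ (boundaryTime_pos hD hq.1 hq.2).ne'
  set τ : Eucl n × Eucl n → ℝ := fun q => boundaryTime D q.1 q.2 with hτdef
  have hT' : 0 < τ (x, v) := hT
  have hd : EqOn (fun q => pd (0, w) (funk D) q * τ q + funk D q * pd (0, w) τ q)
      (fun _ => 0) (slitTangent D) := by
    intro q hq
    have := pd_congr (u := ((0, w) : Eucl n × Eucl n)) hone hΩ hq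
    rw [pd_mul hΩ hk hτ hq] at this
    simpa [pd] using this
  have hd2 := pd_congr (u := ((0, w) : Eucl n × Eucl n)) hd hΩ hp
  have hkw := contDiffOn_pd hk hΩ (0, w)
  have hτw := contDiffOn_pd hτ hΩ (0, w)
  rw [pd_add hΩ (hkw.mul hτ) (hk.mul hτw) hp, pd_mul hΩ hkw hτ hp, pd_mul hΩ hk hτw hp, h] at hd2
  have h0 := hd hp
  simp only [h, zero_mul, zero_add] at h0
  have hkpos := funk_pos hD hx hv
  have hτ0 : pd (0, w) τ (x, v) = 0 := (mul_eq_zero.1 h0).resolve_left hkpos.ne'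
  have := hneg hτ0
  have hconst : pd ((0, w) : Eucl n × Eucl n) (fun _ => (0 : ℝ)) (x, v) = 0 := by simp [pd]
  rw [hconst] at hd2
  by_contra! hcon
  linarith [mul_neg_of_pos_of_neg hkpos this, mul_nonpos_of_nonpos_of_nonneg hcon hT'.le]

/-- By homogeneity `v` is in the kernel of the vertical Hessian. A multiple of `v` can thus be added
to `w` to make a first derivative vanish. -/
theorem pd_pd_add_smul_radial (hΩ : IsOpen Ω) (hf : ContDiffOn ℝ ∞ f Ω)
    (hE : ∀ q ∈ Ω, pd (0, q.2) f q = f q) (h : (x, v) ∈ Ω) (w : Eucl n) (c : ℝ) :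
    pd (0, w + c • v) (pd (0, w + c • v) f) (x, v) = pd (0, w) (pd (0, w) f) (x, v) := by
  have hdir : ((0, w + c • v) : Eucl n × Eucl n) = (0, w) + c • (0, v) := by simp
  have h0 := pd_radial_pd_fibre hΩ hf hE h
  rw [hdir, pd_add_dir, pd_smul_dir, ← hdir, h0, pd_comm hΩ hf h, hdir, pd_add_dir, pd_smul_dir,
    h0]
  ring

theorem pd_funk_radial_of_mem (hD : IsStronglyConvexDomain D) :
    ∀ q ∈ slitTangent D, pd (0, q.2) (funk D) q = funk D q := by
  intro q hq
  rw [mem_slitTangent] at hq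
  exact pd_funk_radial hD hq.1 hq.2

theorem pd_revFunk_radial_of_mem (hD : IsStronglyConvexDomain D) :
    ∀ q ∈ slitTangent D, pd (0, q.2) (revFunk D) q = revFunk D q := by
  intro q hq
  rw [mem_slitTangent] at hq
  exact pd_revFunk_radial hD hq.1 hq.2

theorem pd_pd_funk_pos (hD : IsStronglyConvexDomain D) (hx : x ∈ D) (hv : v ≠ 0)
    (hw : ∀ c : ℝ, w ≠ c • v) : 0 < pd (0, w) (pd (0, w) (funk D)) (x, v) := by
  have hk := funk_pos hD hx hv
  -- As the derivative of `k` along `v` is `k`, this is the multiple for which the derivative along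
  -- `w + c v` vanishes.
  set c : ℝ := -(pd (0, w) (funk D) (x, v) / funk D (x, v)) with hc
  rw [← pd_pd_add_smul_radial (isOpen_slitTangent hD.isOpen) (contDiffOn_funk hD)
    (pd_funk_radial_of_mem hD) (mem_slitTangent.2 ⟨hx, hv⟩) w c]
  refine pd_pd_funk_pos_of_pd_eq_zero hD hx hv ?_ ?_
  · intro h0
    exact hw (-c) (by rw [neg_smul]; exact eq_neg_of_add_eq_zero_left h0)
  · rw [show ((0, w + c • v) : Eucl n × Eucl n) = (0, w) + c • (0, v) by simp, pd_add_dir,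
      pd_smul_dir, pd_funk_radial hD hx hv, hc]
    field_simp
    ring

theorem pd_pd_revFunk (hD : IsStronglyConvexDomain D) (hx : x ∈ D) (hv : v ≠ 0) :
    pd (0, w) (pd (0, w) (revFunk D)) (x, v) = pd (0, w) (pd (0, w) (funk D)) (x, -v) := by
  have hΩ := isOpen_slitTangent hD.isOpen
  have h1 := hasDerivAt_fibre_line (x := x) (v := v) (w := w) (s := 0) hΩ
    (contDiffOn_pd (contDiffOn_revFunk hD) hΩ (0, w)) (mem_slitTangent.2 ⟨hx, by simpa⟩)
  have h2 := hasDerivAt_fibre_line (x := x) (v := -v) (w := -w) (s := 0) hΩ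
    (contDiffOn_pd (contDiffOn_funk hD) hΩ (0, -w)) (mem_slitTangent.2 ⟨hx, by simpa⟩)
  have hne : ∀ᶠ s in 𝓝 (0 : ℝ), v + s • w ≠ 0 := by
    have : Filter.Tendsto (fun s : ℝ => v + s • w) (𝓝 0) (𝓝 v) := by
      simpa using (hasDerivAt_line v w 0).continuousAt.tendsto
    exact this.eventually (isOpen_ne.mem_nhds hv)
  have h3 : (fun s : ℝ => pd (0, w) (revFunk D) (x, v + s • w)) =ᶠ[𝓝 0]
      fun s : ℝ => pd (0, -w) (funk D) (x, -v + s • -w) := by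
    filter_upwards [hne] with s hs
    rw [pd_revFunk hD hx hs, neg_add, smul_neg]
  have h4 := h1.unique (h2.congr_of_eventuallyEq h3)
  simp only [zero_smul, add_zero] at h4
  have hneg : ((0, -w) : Eucl n × Eucl n) = -(0, w) := by simp
  have hp : (x, -v) ∈ slitTangent D := mem_slitTangent.2 ⟨hx, neg_ne_zero.2 hv⟩
  rw [h4]
  conv_lhs => rw [hneg, pd_neg_dir, ← hneg, pd_comm hΩ (contDiffOn_funk hD) hp]
  rw [hneg, pd_neg_dir, neg_neg]

theorem pd_pd_revFunk_pos (hD : IsStronglyConvexDomain D) (hx : x ∈ D) (hv : v ≠ 0)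
    (hw : ∀ c : ℝ, w ≠ c • v) : 0 < pd (0, w) (pd (0, w) (revFunk D)) (x, v) := by
  rw [pd_pd_revFunk hD hx hv]
  refine pd_pd_funk_pos hD hx (neg_ne_zero.2 hv) fun c => ?_
  rw [smul_neg, ← neg_smul]
  exact hw _

end FunkHessian

/-! ### The Hilbert metric as the mean of the two Funk metrics -/

section HilbertMetric

variable {n : ℕ} {D : Set (Eucl n)} {x v w : Eucl n}

theorem hilbertMetric_eq (hD : IsStronglyConvexDomain D) (hx : x ∈ D) (v : Eucl n) :
    hilbertMetric D x v = 1 / 2 * (funk D (x, v) + revFunk D (x, v)) := by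
  rcases eq_or_ne v 0 with rfl | hv
  · have h1 := funk_smul (v := (0 : Eucl n)) hD hx le_rfl
    have h2 := revFunk_smul (v := (0 : Eucl n)) hD hx le_rfl
    rw [smul_zero, zero_mul] at h1 h2
    simp [hilbertMetric, h1, h2]
  · have h1 := boundaryTime_pos hD hx hv
    have h2 := boundaryTime_pos hD hx (neg_ne_zero.2 hv)
    have hn : ‖v‖ ≠ 0 := norm_ne_zero_iff.2 hv
    simp only [hilbertMetric, boundaryPoint, sub_add_cancel_left, norm_neg, norm_smul,
      Real.norm_of_nonneg h1.le, Real.norm_of_nonneg h2.le, funk, revFunk]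
    field_simp
    ring

theorem contDiffOn_hilbertMetric (hD : IsStronglyConvexDomain D) :
    ContDiffOn ℝ ∞ (fun q : Eucl n × Eucl n => hilbertMetric D q.1 q.2) (slitTangent D) :=
  (contDiffOn_const.mul ((contDiffOn_funk hD).add (contDiffOn_revFunk hD))).congr
    fun q hq => hilbertMetric_eq hD (mem_slitTangent.1 hq).1 q.2

theorem hilbertMetric_nonneg (D : Set (Eucl n)) (x v : Eucl n) : 0 ≤ hilbertMetric D x v := by
  unfold hilbertMetric
  positivity

theorem hilbertMetric_pos (hD : IsStronglyConvexDomain D) (hx : x ∈ D) (hv : v ≠ 0) :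
    0 < hilbertMetric D x v := by
  rw [hilbertMetric_eq hD hx]
  linarith [funk_pos hD hx hv, revFunk_pos hD hx hv]

theorem hilbertMetric_smul (hD : IsStronglyConvexDomain D) (hx : x ∈ D) {c : ℝ} (hc : 0 ≤ c)
    (v : Eucl n) : hilbertMetric D x (c • v) = c * hilbertMetric D x v := by
  rw [hilbertMetric_eq hD hx, hilbertMetric_eq hD hx, funk_smul hD hx hc, revFunk_smul hD hx hc]
  ring

theorem pd_hilbertMetric (hD : IsStronglyConvexDomain D) {q : Eucl n × Eucl n}
    (hq : q ∈ slitTangent D) (u : Eucl n × Eucl n) :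
    pd u (fun q : Eucl n × Eucl n => hilbertMetric D q.1 q.2) q =
      1 / 2 * (pd u (funk D) q + pd u (revFunk D) q) := by
  have hΩ := isOpen_slitTangent hD.isOpen
  have h : EqOn (fun q : Eucl n × Eucl n => hilbertMetric D q.1 q.2)
      (fun q => 1 / 2 * (funk D q + revFunk D q)) (slitTangent D) :=
    fun q hq => hilbertMetric_eq hD (mem_slitTangent.1 hq).1 q.2
  rw [pd_congr h hΩ hq, pd_const_mul hΩ _ ((contDiffOn_funk hD).add (contDiffOn_revFunk hD)) hq,
    pd_add hΩ (contDiffOn_funk hD) (contDiffOn_revFunk hD) hq]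

theorem pd_pd_hilbertMetric (hD : IsStronglyConvexDomain D) {q : Eucl n × Eucl n}
    (hq : q ∈ slitTangent D) (u u' : Eucl n × Eucl n) :
    pd u (pd u' fun q : Eucl n × Eucl n => hilbertMetric D q.1 q.2) q =
      1 / 2 * (pd u (pd u' (funk D)) q + pd u (pd u' (revFunk D)) q) := by
  have hΩ := isOpen_slitTangent hD.isOpen
  have h1 := contDiffOn_pd (contDiffOn_funk hD) hΩ u'
  have h2 := contDiffOn_pd (contDiffOn_revFunk hD) hΩ u'
  have h : EqOn (pd u' fun q : Eucl n × Eucl n => hilbertMetric D q.1 q.2)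
      (fun q => 1 / 2 * (pd u' (funk D) q + pd u' (revFunk D) q)) (slitTangent D) :=
    fun q hq => pd_hilbertMetric hD hq u'
  rw [pd_congr h hΩ hq, pd_const_mul hΩ _ (h1.add h2) hq, pd_add hΩ h1 h2 hq]

theorem pd_hilbertMetric_radial (hD : IsStronglyConvexDomain D) :
    ∀ q ∈ slitTangent D, pd (0, q.2) (fun q : Eucl n × Eucl n => hilbertMetric D q.1 q.2) q =
      hilbertMetric D q.1 q.2 := by
  intro q hq
  rw [pd_hilbertMetric hD hq, pd_funk_radial_of_mem hD q hq, pd_revFunk_radial_of_mem hD q hq,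
    hilbertMetric_eq hD (mem_slitTangent.1 hq).1]

end HilbertMetric

/-! ### The fundamental tensor of a homogeneous function -/

section FundamentalTensor

variable {n : ℕ} {Ω : Set (Eucl n × Eucl n)} {F : Eucl n → Eucl n → ℝ}
  {H : Eucl n × Eucl n → ℝ} {x v w : Eucl n}

theorem partialV_eq_pd_of_eqOn (hΩ : IsOpen Ω) (hH : ContDiffOn ℝ ∞ H Ω)
    (h : ∀ q ∈ Ω, F q.1 q.2 = H q) (k : Fin n) :
    ∀ q ∈ Ω, partialV k F q.1 q.2 = pd (dirV k) H q := by
  intro q hq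
  rw [partialV_eq_pd hΩ (hH.congr h) hq]
  exact pd_congr h hΩ hq

theorem partialX_eq_pd_of_eqOn (hΩ : IsOpen Ω) (hH : ContDiffOn ℝ ∞ H Ω)
    (h : ∀ q ∈ Ω, F q.1 q.2 = H q) (k : Fin n) :
    ∀ q ∈ Ω, partialX k F q.1 q.2 = pd (dirX k) H q := by
  intro q hq
  rw [partialX_eq_pd hΩ (hH.congr h) hq]
  exact pd_congr h hΩ hq

theorem sum_mul_pd_pd_dirV (hΩ : IsOpen Ω) (hH : ContDiffOn ℝ ∞ H Ω) (h : (x, v) ∈ Ω)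
    (u : Eucl n × Eucl n) (w : Eucl n) :
    ∑ j, w j * pd u (pd (dirV j) H) (x, v) = pd u (pd (0, w) H) (x, v) := by
  rw [pd_comm hΩ hH h, ← sum_mul_pd_dirV]
  exact Finset.sum_congr rfl fun j _ => by rw [pd_comm hΩ hH h]

theorem partialV_energy (hΩ : IsOpen Ω) (hH : ContDiffOn ℝ ∞ H Ω)
    (h : ∀ q ∈ Ω, F q.1 q.2 = H q) (k : Fin n) :
    ∀ q ∈ Ω, partialV k (energy F) q.1 q.2 = 2 * H q * pd (dirV k) H q := by
  intro q hq
  rw [partialV_eq_pd_of_eqOn (H := fun q => H q ^ 2) hΩ (hH.pow 2)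
    (fun q hq => by rw [energy, h q hq]) k q hq, pd_sq hΩ hH hq]

theorem fundamentalTensor_apply (hΩ : IsOpen Ω) (hH : ContDiffOn ℝ ∞ H Ω)
    (h : ∀ q ∈ Ω, F q.1 q.2 = H q) (hp : (x, v) ∈ Ω) (i j : Fin n) :
    fundamentalTensor F x v i j = pd (dirV i) H (x, v) * pd (dirV j) H (x, v) +
      H (x, v) * pd (dirV i) (pd (dirV j) H) (x, v) := by
  have hHj := contDiffOn_pd hH hΩ (dirV j)
  have h1 := partialV_eq_pd_of_eqOn (H := fun q => 2 * H q * pd (dirV j) H q) hΩ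
    ((contDiffOn_const.mul hH).mul hHj) (partialV_energy hΩ hH h j) i (x, v) hp
  simp only [fundamentalTensor, Matrix.of_apply]
  change 1 / 2 * partialV i (partialV j (energy F)) x v = _
  rw [h1, pd_mul hΩ (contDiffOn_const.mul hH) hHj hp, pd_const_mul hΩ _ hH hp]
  ring

theorem sum_mul_fundamentalTensor (hΩ : IsOpen Ω) (hH : ContDiffOn ℝ ∞ H Ω)
    (h : ∀ q ∈ Ω, F q.1 q.2 = H q) (hp : (x, v) ∈ Ω) (i : Fin n) (w : Eucl n) :
    ∑ j, fundamentalTensor F x v i j * w j = pd (dirV i) H (x, v) * pd (0, w) H (x, v) +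
      H (x, v) * pd (dirV i) (pd (0, w) H) (x, v) := by
  rw [← sum_mul_pd_pd_dirV hΩ hH hp, ← sum_mul_pd_dirV, Finset.mul_sum, Finset.mul_sum,
    ← Finset.sum_add_distrib]
  refine Finset.sum_congr rfl fun j _ => ?_
  rw [fundamentalTensor_apply hΩ hH h hp]
  ring

theorem dotProduct_fundamentalTensor_mulVec (hΩ : IsOpen Ω) (hH : ContDiffOn ℝ ∞ H Ω)
    (h : ∀ q ∈ Ω, F q.1 q.2 = H q) (hp : (x, v) ∈ Ω) (w : Eucl n) :
    dotProduct w.ofLp ((fundamentalTensor F x v).mulVec w.ofLp) =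
      pd (0, w) H (x, v) ^ 2 + H (x, v) * pd (0, w) (pd (0, w) H) (x, v) := by
  simp only [dotProduct, Matrix.mulVec]
  rw [Finset.sum_congr rfl fun i _ => by rw [sum_mul_fundamentalTensor hΩ hH h hp i w],
    ← sum_mul_pd_dirV w (pd (0, w) H), pow_two]
  conv_rhs => enter [1, 1]; rw [← sum_mul_pd_dirV w H]
  rw [Finset.mul_sum, Finset.sum_mul, ← Finset.sum_add_distrib]
  exact Finset.sum_congr rfl fun i _ => by ring

theorem fundamentalTensor_isHermitian (hΩ : IsOpen Ω) (hH : ContDiffOn ℝ ∞ H Ω)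
    (h : ∀ q ∈ Ω, F q.1 q.2 = H q) (hp : (x, v) ∈ Ω) :
    (fundamentalTensor F x v).IsHermitian := by
  ext i j
  rw [Matrix.conjTranspose_apply, star_trivial, fundamentalTensor_apply hΩ hH h hp,
    fundamentalTensor_apply hΩ hH h hp, pd_comm hΩ hH hp]
  ring

/-- The quadratic form is `(dF(w))² + F Hess F (w, w)`. For `w = c v` the first term is `c² F² > 0`;
for every other nonzero `w` the second term is positive. -/
theorem fundamentalTensor_posDef (hΩ : IsOpen Ω) (hH : ContDiffOn ℝ ∞ H Ω)
    (h : ∀ q ∈ Ω, F q.1 q.2 = H q) (hE : ∀ q ∈ Ω, pd (0, q.2) H q = H q) (hp : (x, v) ∈ Ω)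
    (hpos : 0 < H (x, v))
    (hess : ∀ w : Eucl n, (∀ c : ℝ, w ≠ c • v) → 0 < pd (0, w) (pd (0, w) H) (x, v)) :
    (fundamentalTensor F x v).PosDef := by
  refine Matrix.PosDef.of_dotProduct_mulVec_pos (fundamentalTensor_isHermitian hΩ hH h hp) ?_
  intro w hw
  rw [star_trivial]
  have := dotProduct_fundamentalTensor_mulVec hΩ hH h hp (WithLp.toLp 2 w)
  rw [this]
  by_cases hc : ∃ c : ℝ, WithLp.toLp 2 w = c • v
  · obtain ⟨c, hc⟩ := hc
    have hc0 : c ≠ 0 := by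
      rintro rfl
      rw [zero_smul, WithLp.toLp_eq_zero] at hc
      exact hw hc
    have hE' : pd (0, v) H (x, v) = H (x, v) := hE (x, v) hp
    have hdir : ((0, c • v) : Eucl n × Eucl n) = c • (0, v) := by simp
    rw [hc, hdir, pd_smul_dir, pd_smul_dir, pd_comm hΩ hH hp, pd_smul_dir,
      pd_radial_pd_fibre hΩ hH hE hp, hE']
    have := mul_ne_zero hc0 hpos.ne'
    simp only [mul_zero, add_zero]
    positivity
  · push Not at hc
    have := mul_pos hpos (hess _ hc)
    positivity

end FundamentalTensor

/-! ### The Hilbert metric is a Finsler structure -/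

section Hilbert

variable {n : ℕ} {D : Set (Eucl n)} {x v w : Eucl n}

theorem fundamentalTensor_hilbertMetric_posDef (hD : IsStronglyConvexDomain D) (hx : x ∈ D)
    (hv : v ≠ 0) : (fundamentalTensor (hilbertMetric D) x v).PosDef := by
  have hp : (x, v) ∈ slitTangent D := mem_slitTangent.2 ⟨hx, hv⟩
  refine fundamentalTensor_posDef (isOpen_slitTangent hD.isOpen) (contDiffOn_hilbertMetric hD)
    (fun _ _ => rfl) (pd_hilbertMetric_radial hD) hp (hilbertMetric_pos hD hx hv) fun w hw => ?_
  rw [pd_pd_hilbertMetric hD hp]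
  linarith [pd_pd_funk_pos hD hx hv hw, pd_pd_revFunk_pos hD hx hv hw]

theorem isFinslerStructure_hilbertMetric (hD : IsStronglyConvexDomain D) :
    IsFinslerStructure D (hilbertMetric D) where
  nonneg x _ v := hilbertMetric_nonneg D x v
  smooth := contDiffOn_hilbertMetric hD
  homogeneous _ hx v _ hc := hilbertMetric_smul hD hx hc.le v
  posDef _ hx _ hv := fundamentalTensor_hilbertMetric_posDef hD hx hv

end Hilbert

/-! ### Ricci curvature of a projectively flat spray -/

section Ricci

variable {n : ℕ} {Ω : Set (Eucl n × Eucl n)} {F : Eucl n → Eucl n → ℝ}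
  {P : Eucl n × Eucl n → ℝ} {x v w : Eucl n}

theorem dirX_snd (i j : Fin n) : (dirX i).2 j = 0 := by simp [dirX]

theorem dirV_snd (i j : Fin n) : (dirV i).2 j = if i = j then 1 else 0 := by
  simp [dirV, eq_comm]

/-- The Ricci curvature of a projectively flat Finsler structure, whose spray coefficients are
`Gⁱ = P vⁱ`. -/
theorem finslerRicci_of_sprayCoeff_eq (hΩ : IsOpen Ω) (hP : ContDiffOn ℝ ∞ P Ω)
    (hE : ∀ q ∈ Ω, pd (0, q.2) P q = P q)
    (hG : ∀ i, ∀ q ∈ Ω, sprayCoeff F i q.1 q.2 = q.2 i * P q) (hp : (x, v) ∈ Ω) :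
    finslerRicci F x v = (n - 1) * (P (x, v) ^ 2 - pd (v, 0) P (x, v)) := by
  have hG' (i : Fin n) : ContDiffOn ℝ ∞ (fun q : Eucl n × Eucl n => q.2 i * P q) Ω :=
    (contDiffOn_coord i).mul hP
  have hPi (i : Fin n) := contDiffOn_pd hP hΩ (dirV i)
  have hN (i k : Fin n) : ∀ q ∈ Ω, nonlinearConnection F i k q.1 q.2 =
      (if k = i then 1 else 0) * P q + q.2 i * pd (dirV k) P q := by
    intro q hq
    change partialV k (sprayCoeff F i) q.1 q.2 = _
    rw [partialV_eq_pd_of_eqOn hΩ (hG' i) (hG i) k q hq, pd_mul hΩ (contDiffOn_coord i) hP hq,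
      pd_coord, dirV_snd]
  have hN' (i k : Fin n) : ContDiffOn ℝ ∞
      (fun q : Eucl n × Eucl n => (if k = i then 1 else 0) * P q + q.2 i * pd (dirV k) P q) Ω :=
    (contDiffOn_const.mul hP).add ((contDiffOn_coord i).mul (hPi k))
  have hpdN (i k : Fin n) (u : Eucl n × Eucl n) :
      pd u (fun q : Eucl n × Eucl n =>
        (if k = i then 1 else 0) * P q + q.2 i * pd (dirV k) P q) (x, v) =
      (if k = i then 1 else 0) * pd u P (x, v) +
        (u.2 i * pd (dirV k) P (x, v) + v i * pd u (pd (dirV k) P) (x, v)) := by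
    rw [pd_add hΩ (contDiffOn_const.mul hP) ((contDiffOn_coord i).mul (hPi k)) hp,
      pd_const_mul hΩ _ hP hp, pd_mul hΩ (contDiffOn_coord i) (hPi k) hp, pd_coord]
  have hE0 : pd (0, v) P (x, v) = P (x, v) := hE (x, v) hp
  -- With `Nⁱₖ = δⁱₖ P + vⁱ ∂P/∂vᵏ`, Euler's identities for `P` (degree one) and for its fibre
  -- derivatives (degree zero) evaluate each sum over `j`. What remains is a combination whose trace
  -- is again computed by Euler.
  have hR (i : Fin n) : riemannCurvature F i i x v =
      2 * (v i * pd (dirX i) P (x, v)) -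
        (pd (v, 0) P (x, v) + v i * pd (dirV i) (pd (v, 0) P) (x, v)) +
        2 * P (x, v) * (P (x, v) + v i * pd (dirV i) P (x, v)) -
        (P (x, v) ^ 2 + 3 * P (x, v) * (v i * pd (dirV i) P (x, v))) := by
    have t1 : partialX i (sprayCoeff F i) x v = v i * pd (dirX i) P (x, v) := by
      have := partialX_eq_pd_of_eqOn hΩ (hG' i) (hG i) i (x, v) hp
      rw [pd_mul hΩ (contDiffOn_coord i) hP hp, pd_coord, dirX_snd] at this
      simpa using this
    have t2 : ∑ j, v j * partialX j (nonlinearConnection F i i) x v =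
        pd (v, 0) P (x, v) + v i * pd (dirV i) (pd (v, 0) P) (x, v) := by
      rw [pd_comm hΩ hP hp, ← sum_mul_pd_dirX v P, ← sum_mul_pd_dirX v (pd (dirV i) P),
        Finset.mul_sum, ← Finset.sum_add_distrib]
      refine Finset.sum_congr rfl fun j _ => ?_
      have := partialX_eq_pd_of_eqOn hΩ (hN' i i) (hN i i) j (x, v) hp
      rw [hpdN, dirX_snd] at this
      change partialX j (nonlinearConnection F i i) x v = _ at this
      rw [this, if_pos rfl]
      ring
    have t3 : ∑ j, sprayCoeff F j x v * partialV j (nonlinearConnection F i i) x v =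
        P (x, v) * (P (x, v) + v i * pd (dirV i) P (x, v)) := by
      have (j : Fin n) : sprayCoeff F j x v * partialV j (nonlinearConnection F i i) x v =
          P (x, v) * (v j * pd (dirV j) P (x, v)) +
          (P (x, v) * v i) * (v j * pd (dirV j) (pd (dirV i) P) (x, v)) +
          (if j = i then P (x, v) * (v i * pd (dirV i) P (x, v)) else 0) := by
        have h1 := partialV_eq_pd_of_eqOn hΩ (hN' i i) (hN i i) j (x, v) hp
        rw [hpdN, dirV_snd] at h1
        change partialV j (nonlinearConnection F i i) x v = _ at h1
        have h2 : sprayCoeff F j x v = v j * P (x, v) := hG j (x, v) hp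
        rw [h1, h2, if_pos rfl]
        split_ifs with h
        · subst h; ring
        · ring
      rw [Finset.sum_congr rfl fun j _ => this j, Finset.sum_add_distrib, Finset.sum_add_distrib,
        ← Finset.mul_sum, ← Finset.mul_sum, sum_mul_pd_dirV, sum_mul_pd_dirV, hE0, dirV,
        pd_radial_pd_fibre hΩ hP hE hp]
      simp
      ring
    have t4 : ∑ j, nonlinearConnection F i j x v * nonlinearConnection F j i x v =
        P (x, v) ^ 2 + 3 * P (x, v) * (v i * pd (dirV i) P (x, v)) := by
      have (j : Fin n) : nonlinearConnection F i j x v * nonlinearConnection F j i x v =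
          (v i * pd (dirV i) P (x, v)) * (v j * pd (dirV j) P (x, v)) +
          (if j = i then P (x, v) ^ 2 + 2 * P (x, v) * (v i * pd (dirV i) P (x, v)) else 0) := by
        have h1 : nonlinearConnection F i j x v = _ := hN i j (x, v) hp
        have h2 : nonlinearConnection F j i x v = _ := hN j i (x, v) hp
        rw [h1, h2]
        by_cases h : j = i
        · subst h; simp; ring
        · simp [h, Ne.symm h]; ring
      rw [Finset.sum_congr rfl fun j _ => this j, Finset.sum_add_distrib, ← Finset.mul_sum,
        sum_mul_pd_dirV, hE0]
      simp
      ring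
    rw [riemannCurvature, t1, t2, t3, t4]
    ring
  rw [finslerRicci, Finset.sum_congr rfl fun i _ => hR i]
  simp only [Finset.sum_add_distrib, Finset.sum_sub_distrib, ← Finset.mul_sum, sum_mul_pd_dirX,
    sum_mul_pd_dirV, hE0, pd_radial_pd hΩ hP hE hp, Finset.sum_const, Finset.card_univ,
    Fintype.card_fin, nsmul_eq_mul]
  -- The direction `(v, 0)` has no fibre component, so the correction term in Euler's identity for
  -- `pd (v, 0) P` is a derivative in the zero direction.
  have : pd ((0, 0) : Eucl n × Eucl n) P (x, v) = 0 := by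
    rw [show ((0, 0) : Eucl n × Eucl n) = 0 from rfl, pd, map_zero]
  rw [this]
  ring

end Ricci

/-! ### Spray and Ricci curvature of the Hilbert metric -/

section HilbertSpray

variable {n : ℕ} {D : Set (Eucl n)} {x v w : Eucl n}

theorem pd_base_pd_funk (hD : IsStronglyConvexDomain D) (hx : x ∈ D) (hv : v ≠ 0) (w : Eucl n)
    (u : Eucl n × Eucl n) :
    pd (w, 0) (pd u (funk D)) (x, v) = pd u (funk D) (x, v) * pd (0, w) (funk D) (x, v) +
      funk D (x, v) * pd u (pd (0, w) (funk D)) (x, v) := by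
  have hΩ := isOpen_slitTangent hD.isOpen
  have hk := contDiffOn_funk hD
  have hp : (x, v) ∈ slitTangent D := mem_slitTangent.2 ⟨hx, hv⟩
  have h : EqOn (pd (w, 0) (funk D)) (fun q => funk D q * pd (0, w) (funk D) q)
      (slitTangent D) := fun q hq =>
    pd_funk_base hD (mem_slitTangent.1 hq).1 (mem_slitTangent.1 hq).2 w
  rw [pd_comm hΩ hk hp, pd_congr h hΩ hp, pd_mul hΩ hk (contDiffOn_pd hk hΩ _) hp]

theorem pd_base_pd_revFunk (hD : IsStronglyConvexDomain D) (hx : x ∈ D) (hv : v ≠ 0) (w : Eucl n)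
    (u : Eucl n × Eucl n) :
    pd (w, 0) (pd u (revFunk D)) (x, v) = -(pd u (revFunk D) (x, v) * pd (0, w) (revFunk D) (x, v) +
      revFunk D (x, v) * pd u (pd (0, w) (revFunk D)) (x, v)) := by
  have hΩ := isOpen_slitTangent hD.isOpen
  have hk := contDiffOn_revFunk hD
  have hp : (x, v) ∈ slitTangent D := mem_slitTangent.2 ⟨hx, hv⟩
  have h : EqOn (pd (w, 0) (revFunk D)) (fun q => (-1) * (revFunk D q * pd (0, w) (revFunk D) q))
      (slitTangent D) := fun q hq => by
    have := pd_revFunk_base hD (mem_slitTangent.1 hq).1 (mem_slitTangent.1 hq).2 w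
    change pd (w, 0) (revFunk D) q = _ at this
    rw [this]
    ring
  rw [pd_comm hΩ hk hp, pd_congr h hΩ hp,
    pd_const_mul hΩ _ (hk.mul (contDiffOn_pd hk hΩ _)) hp,
    pd_mul hΩ hk (contDiffOn_pd hk hΩ _) hp]
  ring

/-- The projective factor of the Hilbert metric. -/
noncomputable def hilbertFactor {n : ℕ} (D : Set (Eucl n)) (q : Eucl n × Eucl n) : ℝ :=
  1 / 2 * (funk D q - revFunk D q)

theorem contDiffOn_hilbertFactor (hD : IsStronglyConvexDomain D) :
    ContDiffOn ℝ ∞ (hilbertFactor D) (slitTangent D) :=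
  contDiffOn_const.mul ((contDiffOn_funk hD).sub (contDiffOn_revFunk hD))

theorem pd_hilbertFactor (hD : IsStronglyConvexDomain D) {q : Eucl n × Eucl n}
    (hq : q ∈ slitTangent D) (u : Eucl n × Eucl n) :
    pd u (hilbertFactor D) q = 1 / 2 * (pd u (funk D) q - pd u (revFunk D) q) := by
  have hΩ := isOpen_slitTangent hD.isOpen
  change pd u (fun q => 1 / 2 * (funk D q - revFunk D q)) q = _
  rw [pd_const_mul hΩ _ ((contDiffOn_funk hD).sub (contDiffOn_revFunk hD)) hq,
    pd_sub hΩ (contDiffOn_funk hD) (contDiffOn_revFunk hD) hq]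

/-- Okada's equations give `v·∂ₓF = (k² - k'²) / 2 = 2 P F` and `v·∂ₓ(∂F/∂vˡ) = ∂F/∂xˡ`. The bracket
in the spray coefficient thus reduces to `4 P F ∂F/∂vˡ = 4 P ∑ₘ gₗₘ vᵐ`, and the inverse of `g`
returns `4 P vⁱ`. -/
theorem sprayCoeff_hilbertMetric (hD : IsStronglyConvexDomain D) (hx : x ∈ D) (hv : v ≠ 0)
    (i : Fin n) : sprayCoeff (hilbertMetric D) i x v = v i * hilbertFactor D (x, v) := by
  have hΩ := isOpen_slitTangent hD.isOpen
  have hH := contDiffOn_hilbertMetric hD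
  have hp : (x, v) ∈ slitTangent D := mem_slitTangent.2 ⟨hx, hv⟩
  set H : Eucl n × Eucl n → ℝ := fun q => hilbertMetric D q.1 q.2 with hHdef
  have hr : ∀ q ∈ slitTangent D, hilbertMetric D q.1 q.2 = H q := fun _ _ => rfl
  have hE := pd_hilbertMetric_radial hD
  have hE0 : pd (0, v) H (x, v) = H (x, v) := hE (x, v) hp
  have hHk : H (x, v) = 1 / 2 * (funk D (x, v) + revFunk D (x, v)) := hilbertMetric_eq hD hx v
  have hinner (l : Fin n) :
      (∑ k, v k * partialX k (partialV l (energy (hilbertMetric D))) x v) -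
        partialX l (energy (hilbertMetric D)) x v =
      4 * hilbertFactor D (x, v) * ∑ m, fundamentalTensor (hilbertMetric D) x v l m * v m := by
    have hHl := contDiffOn_pd hH hΩ (dirV l)
    have h1 (k : Fin n) : partialX k (partialV l (energy (hilbertMetric D))) x v =
        2 * (pd (dirX k) H (x, v) * pd (dirV l) H (x, v) +
          H (x, v) * pd (dirX k) (pd (dirV l) H) (x, v)) := by
      have := partialX_eq_pd_of_eqOn (H := fun q => 2 * H q * pd (dirV l) H q) hΩ
        ((contDiffOn_const.mul hH).mul hHl) (partialV_energy hΩ hH hr l) k (x, v) hp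
      change partialX k (partialV l (energy (hilbertMetric D))) x v = _ at this
      rw [this, pd_mul hΩ (contDiffOn_const.mul hH) hHl hp, pd_const_mul hΩ _ hH hp]
      ring
    have h2 : partialX l (energy (hilbertMetric D)) x v = 2 * H (x, v) * pd (dirX l) H (x, v) := by
      have := partialX_eq_pd_of_eqOn (F := energy (hilbertMetric D)) (H := fun q => H q ^ 2) hΩ
        (hH.pow 2) (fun _ _ => rfl) l (x, v) hp
      change partialX l (energy (hilbertMetric D)) x v = _ at this
      rw [this, pd_sq hΩ hH hp]
    have h3 : ∑ k, v k * partialX k (partialV l (energy (hilbertMetric D))) x v =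
        2 * (pd (v, 0) H (x, v) * pd (dirV l) H (x, v) +
          H (x, v) * pd (v, 0) (pd (dirV l) H) (x, v)) := by
      rw [← sum_mul_pd_dirX v H, ← sum_mul_pd_dirX v (pd (dirV l) H), Finset.mul_sum,
        Finset.sum_mul, ← Finset.sum_add_distrib, Finset.mul_sum]
      exact Finset.sum_congr rfl fun k _ => by rw [h1]; ring
    have hrk : pd (0, v) (funk D) (x, v) = funk D (x, v) := pd_funk_radial hD hx hv
    have hrb : pd (0, v) (revFunk D) (x, v) = revFunk D (x, v) := pd_revFunk_radial hD hx hv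
    have h4 := pd_base_pd_funk hD hx hv v (dirV l)
    have h5 := pd_base_pd_revFunk hD hx hv v (dirV l)
    rw [pd_comm hΩ (contDiffOn_funk hD) hp (u := dirV l), dirV,
      pd_radial_pd_fibre hΩ (contDiffOn_funk hD) (pd_funk_radial_of_mem hD) hp, ← dirV, hrk] at h4
    rw [pd_comm hΩ (contDiffOn_revFunk hD) hp (u := dirV l), dirV,
      pd_radial_pd_fibre hΩ (contDiffOn_revFunk hD) (pd_revFunk_radial_of_mem hD) hp, ← dirV,
      hrb] at h5
    rw [h3, h2, sum_mul_fundamentalTensor hΩ hH hr hp, hE0, pd_comm hΩ hH hp (u := dirV l)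
      (w := (0, v)), dirV, pd_radial_pd_fibre hΩ hH hE hp, ← dirV, pd_hilbertMetric hD hp,
      pd_pd_hilbertMetric hD hp, pd_hilbertMetric hD hp, pd_hilbertMetric hD hp, h4, h5,
      pd_funk_base hD hx hv, pd_revFunk_base hD hx hv, dirX, pd_funk_base hD hx hv,
      pd_revFunk_base hD hx hv, ← dirV, hrk, hrb, hHk, hilbertFactor]
    ring
  have hdet := (fundamentalTensor_hilbertMetric_posDef hD hx hv).det_pos.ne'
  have hinv : ∑ l, (fundamentalTensor (hilbertMetric D) x v)⁻¹ i l *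
      ∑ m, fundamentalTensor (hilbertMetric D) x v l m * v m = v i := by
    have := congrFun (congrArg (fun M => Matrix.mulVec M v.ofLp)
      (Matrix.nonsing_inv_mul _ (isUnit_iff_ne_zero.2 hdet))) i
    simp only [← Matrix.mulVec_mulVec, Matrix.one_mulVec] at this
    exact this
  have hterm (l : Fin n) := congrArg
    (fun t => (fundamentalTensor (hilbertMetric D) x v)⁻¹ i l * t) (hinner l)
  rw [sprayCoeff, Finset.sum_congr rfl fun l _ => (hterm l).trans (mul_left_comm _ _ _),
    ← Finset.mul_sum, hinv]
  ring

/-- Here `v·∂ₓP = (k² + k'²) / 2`, whence `P² - v·∂ₓP = -(k + k')² / 4 = -F²`. -/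
theorem finslerRicci_hilbertMetric (hD : IsStronglyConvexDomain D) (hx : x ∈ D) (hv : v ≠ 0) :
    finslerRicci (hilbertMetric D) x v = -((n : ℝ) - 1) * hilbertMetric D x v ^ 2 := by
  have hp : (x, v) ∈ slitTangent D := mem_slitTangent.2 ⟨hx, hv⟩
  rw [finslerRicci_of_sprayCoeff_eq (isOpen_slitTangent hD.isOpen) (contDiffOn_hilbertFactor hD)
    ?_ ?_ hp, pd_hilbertFactor hD hp, pd_funk_base hD hx hv, pd_revFunk_base hD hx hv,
    pd_funk_radial hD hx hv, pd_revFunk_radial hD hx hv, hilbertMetric_eq hD hx, hilbertFactor]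
  · ring
  · intro q hq
    rw [pd_hilbertFactor hD hq, pd_funk_radial_of_mem hD q hq, pd_revFunk_radial_of_mem hD q hq,
      hilbertFactor]
  · intro i q hq
    exact sprayCoeff_hilbertMetric hD (mem_slitTangent.1 hq).1 (mem_slitTangent.1 hq).2 i

end HilbertSpray

/-! ### A determinant identity for rank-one perturbations -/

section Determinant

open Matrix in
/-- The determinant of `a A + f fᵀ`, where `v` spans the kernel of `A` and `f v = a`, does not
depend on `f`, and scales like `a ^ (n + 1)`. -/
theorem det_smul_add_vecMulVec {n : ℕ} {A : Matrix (Fin n) (Fin n) ℝ} {v f g : Fin n → ℝ} {a b : ℝ}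
    (ha : 0 < a) (hb : 0 < b) (hA : A.IsSymm) (hAv : A *ᵥ v = 0) (hf : f ⬝ᵥ v = a)
    (hg : g ⬝ᵥ v = b) :
    (a • A + vecMulVec f f).det = (a / b) ^ (n + 1) * (b • A + vecMulVec g g).det := by
  -- The two matrices are congruent up to a scalar. With `Q = 1 + v rᵀ`, the relations `A v = 0` and
  -- `g · v = b` give `Qᵀ (b A + g gᵀ) Q = b A + (g + b r)(g + b r)ᵀ`. The vector `r` is chosen so
  -- that `g + b r = μ⁻¹ f`, and multiplication by `a / b = μ²` yields `a A + f fᵀ`. As `det Q = 1 +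
  -- r · v = μ`, the total factor is `(a / b) ^ n * μ²`.
  set μ := √(a / b) with hμ
  have hab : 0 < a / b := div_pos ha hb
  have hμpos : 0 < μ := Real.sqrt_pos.2 hab
  have hμsq : μ * μ = a / b := Real.mul_self_sqrt hab.le
  set r : Fin n → ℝ := b⁻¹ • (μ⁻¹ • f - g) with hr
  have hvA : v ᵥ* A = 0 := by
    rw [← Matrix.mulVec_transpose, hA.eq, hAv]
  have hgr : g + b • r = μ⁻¹ • f := by
    rw [hr, smul_smul, mul_inv_cancel₀ hb.ne', one_smul]
    abel
  have hrv : r ⬝ᵥ v = μ - 1 := by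
    rw [hr, smul_dotProduct, sub_dotProduct, smul_dotProduct, hf, hg, smul_eq_mul, smul_eq_mul]
    have : a = μ * μ * b := by rw [hμsq]; field_simp
    rw [this]
    field_simp
  have hQ : (1 + vecMulVec v r).det = μ := by
    rw [vecMulVec_eq Unit, det_one_add_replicateCol_mul_replicateRow, hrv]
    ring
  have hQ' : (1 + vecMulVec r v).det = μ := by
    rw [vecMulVec_eq Unit, det_one_add_replicateCol_mul_replicateRow, dotProduct_comm, hrv]
    ring
  have hMQ : (b • A + vecMulVec g g) * (1 + vecMulVec v r) =
      b • A + vecMulVec g (g + b • r) := by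
    rw [mul_add, mul_one, mul_vecMulVec, add_mulVec, smul_mulVec, hAv, vecMulVec_mulVec, hg]
    ext i j
    simp [vecMulVec_apply]
    ring
  have hQMQ : (1 + vecMulVec r v) * (b • A + vecMulVec g (g + b • r)) =
      b • A + vecMulVec (g + b • r) (g + b • r) := by
    rw [add_mul, one_mul, vecMulVec_mul, vecMul_add, vecMul_smul, hvA, vecMul_vecMulVec,
      dotProduct_comm v g, hg]
    ext i j
    simp [vecMulVec_apply]
    ring
  have hfin : a • A + vecMulVec f f =
      (a / b) • ((1 + vecMulVec r v) * ((b • A + vecMulVec g g) * (1 + vecMulVec v r))) := by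
    rw [hMQ, hQMQ, hgr, ← hμsq]
    have : a = μ * μ * b := by rw [hμsq]; field_simp
    ext i j
    simp only [this, Matrix.add_apply, Matrix.smul_apply, vecMulVec_apply, Pi.smul_apply,
      smul_eq_mul]
    field_simp
  rw [hfin, det_smul, det_mul, det_mul, hQ, hQ', Fintype.card_fin, pow_succ, ← hμsq]
  ring

end Determinant

/-! ### The determinant of the fundamental tensor along a line -/

section DeterminantAlongLine

variable {n : ℕ} {D : Set (Eucl n)} {Ω : Set (Eucl n × Eucl n)} {f : Eucl n × Eucl n → ℝ}
  {x v w : Eucl n}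

/-- The vertical Hessian of a solution of Okada's equation is invariant along lines. -/
theorem pd_base_pd_pd_eq_zero (hΩ : IsOpen Ω) (hf : ContDiffOn ℝ ∞ f Ω)
    (hE : ∀ q ∈ Ω, pd (0, q.2) f q = f q) {ε : ℝ}
    (hO : ∀ q ∈ Ω, ∀ w, pd (w, 0) f q = ε * (f q * pd (0, w) f q)) (h : (x, v) ∈ Ω)
    (w w' : Eucl n) : pd (v, 0) (pd (0, w) (pd (0, w') f)) (x, v) = 0 := by
  have hv := contDiffOn_pd hf hΩ (0, v)
  have hw' := contDiffOn_pd hf hΩ (0, w')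
  have hvw' := contDiffOn_pd hv hΩ (0, w')
  have h1 : EqOn (pd (v, 0) (pd (0, w') f))
      (fun q => ε * (pd (0, w') f q * pd (0, v) f q + f q * pd (0, w') (pd (0, v) f) q)) Ω := by
    intro q hq
    have : EqOn (pd (v, 0) f) (fun q => ε * (f q * pd (0, v) f q)) Ω := fun q hq => hO q hq v
    rw [pd_comm hΩ hf hq, pd_congr this hΩ hq, pd_const_mul hΩ _ (hf.mul hv) hq,
      pd_mul hΩ hf hv hq]
  have h0 : ∀ q ∈ Ω, pd (0, q.2) (pd (0, w') f) q = 0 * pd (0, w') f q := fun q hq => by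
    rw [zero_mul]
    exact pd_radial_pd_fibre hΩ hf hE hq w'
  -- The direction `v` is constant here, and the fibre derivative `pd (0, w') f` is homogeneous of
  -- degree zero, so its derivative along `w` has degree `-1`.
  have h2 : pd (0, w) (pd (0, w') (pd (0, v) f)) (x, v) = -pd (0, w) (pd (0, w') f) (x, v) := by
    have hc : EqOn (pd (0, w') (pd (0, v) f)) (pd (0, v) (pd (0, w') f)) Ω :=
      fun q hq => pd_comm hΩ hf hq
    rw [pd_congr hc hΩ h, pd_comm hΩ hw' h, pd_radial_pd_of_homogeneous hΩ hw' h0 h]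
    ring
  -- Of the four terms of the product rule, the two with a second derivative in the directions `v`
  -- and `w` or `w'` vanish. The other two are `f` times the Hessian entry, with opposite signs.
  rw [pd_comm hΩ hw' h, pd_congr h1 hΩ h,
    pd_const_mul hΩ _ ((hw'.mul hv).add (hf.mul hvw')) h,
    pd_add hΩ (hw'.mul hv) (hf.mul hvw') h, pd_mul hΩ hw' hv h, pd_mul hΩ hf hvw' h, h2,
    pd_comm hΩ hf h (u := (0, w)) (w := (0, v)), pd_comm hΩ hf h (u := (0, w')) (w := (0, v)),
    pd_radial_pd_fibre hΩ hf hE h, pd_radial_pd_fibre hΩ hf hE h, hE (x, v) h]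
  ring

theorem pd_base_pd_pd_hilbertMetric (hD : IsStronglyConvexDomain D) (h : (x, v) ∈ slitTangent D)
    (w w' : Eucl n) : pd (v, 0) (pd (0, w) (pd (0, w')
      fun q : Eucl n × Eucl n => hilbertMetric D q.1 q.2)) (x, v) = 0 := by
  have hΩ := isOpen_slitTangent hD.isOpen
  have hk := contDiffOn_pd (contDiffOn_pd (contDiffOn_funk hD) hΩ (0, w')) hΩ (0, w)
  have hb := contDiffOn_pd (contDiffOn_pd (contDiffOn_revFunk hD) hΩ (0, w')) hΩ (0, w)
  have h1 : EqOn (pd (0, w) (pd (0, w') fun q : Eucl n × Eucl n => hilbertMetric D q.1 q.2))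
      (fun q => 1 / 2 * (pd (0, w) (pd (0, w') (funk D)) q +
        pd (0, w) (pd (0, w') (revFunk D)) q)) (slitTangent D) :=
    fun q hq => pd_pd_hilbertMetric hD hq _ _
  rw [pd_congr h1 hΩ h, pd_const_mul hΩ _ (hk.add hb) h, pd_add hΩ hk hb h,
    pd_base_pd_pd_eq_zero (ε := 1) hΩ (contDiffOn_funk hD) (pd_funk_radial_of_mem hD) _ h,
    pd_base_pd_pd_eq_zero (ε := -1) hΩ (contDiffOn_revFunk hD) (pd_revFunk_radial_of_mem hD) _ h]
  · ring
  · intro q hq w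
    have := pd_revFunk_base hD (mem_slitTangent.1 hq).1 (mem_slitTangent.1 hq).2 w
    rw [neg_one_mul, ← neg_mul]
    exact this
  · intro q hq w
    rw [one_mul]
    exact pd_funk_base hD (mem_slitTangent.1 hq).1 (mem_slitTangent.1 hq).2 w

/-- The parameters `t` with `x + t v ∈ D` form a convex, hence connected, open set on which the
derivative of this entry vanishes. -/
theorem pd_pd_hilbertMetric_add_smul (hD : IsStronglyConvexDomain D) (hx : x ∈ D) (hv : v ≠ 0)
    {s : ℝ} (hs : x + s • v ∈ D) (w w' : Eucl n) :
    pd (0, w) (pd (0, w') fun q : Eucl n × Eucl n => hilbertMetric D q.1 q.2) (x + s • v, v) =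
      pd (0, w) (pd (0, w') fun q : Eucl n × Eucl n => hilbertMetric D q.1 q.2) (x, v) := by
  have hΩ := isOpen_slitTangent hD.isOpen
  have hH := contDiffOn_pd (contDiffOn_pd (contDiffOn_hilbertMetric hD) hΩ (0, w')) hΩ (0, w)
  have hcont : Continuous fun t : ℝ => x + t • v := by fun_prop
  have hopen : IsOpen ((fun t : ℝ => x + t • v) ⁻¹' D) := hD.isOpen.preimage hcont
  have hconv : Convex ℝ ((fun t : ℝ => x + t • v) ⁻¹' D) := by
    have : (fun t : ℝ => x + t • v) = AffineMap.lineMap x (x + v) := by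
      ext t
      simp [AffineMap.lineMap_apply_module']
      ring
    rw [this]
    exact hD.convex.affine_preimage _
  have hder : ∀ t ∈ (fun t : ℝ => x + t • v) ⁻¹' D, HasDerivAt (fun t : ℝ =>
      pd (0, w) (pd (0, w') fun q : Eucl n × Eucl n => hilbertMetric D q.1 q.2) (x + t • v, v))
      0 t := by
    intro t ht
    have hm : (x + t • v, v) ∈ slitTangent D := mem_slitTangent.2 ⟨ht, hv⟩
    have := hasDerivAt_base_line hΩ hH hm
    rwa [pd_base_pd_pd_hilbertMetric hD hm] at this
  obtain ⟨c, hc⟩ := hopen.exists_is_const_of_deriv_eq_zero hconv.isPreconnected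
    (fun t ht => (hder t ht).differentiableAt.differentiableWithinAt) fun t ht => (hder t ht).deriv
  have h0 := hc 0 (by simpa using hx)
  simp only [zero_smul, add_zero] at h0
  rw [h0]
  exact hc s hs

theorem fundamentalTensor_hilbertMetric_eq (hD : IsStronglyConvexDomain D)
    (h : (x, v) ∈ slitTangent D) :
    fundamentalTensor (hilbertMetric D) x v = hilbertMetric D x v •
      Matrix.of (fun i j => pd (dirV i) (pd (dirV j)
        fun q : Eucl n × Eucl n => hilbertMetric D q.1 q.2) (x, v)) +
      Matrix.vecMulVec
        (fun i => pd (dirV i) (fun q : Eucl n × Eucl n => hilbertMetric D q.1 q.2) (x, v))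
        (fun i => pd (dirV i) (fun q : Eucl n × Eucl n => hilbertMetric D q.1 q.2) (x, v)) := by
  ext i j
  rw [fundamentalTensor_apply (isOpen_slitTangent hD.isOpen) (contDiffOn_hilbertMetric hD)
    (fun _ _ => rfl) h, Matrix.add_apply, Matrix.smul_apply, Matrix.vecMulVec_apply,
    Matrix.of_apply, smul_eq_mul, add_comm]

/-- In `g = F Hess F + dF ⊗ dF` the Hessian is the same at both points and annihilates `v`, while
`dF(v) = F`. The determinant identity then applies, although `dF` itself varies along the line. -/
theorem det_fundamentalTensor_hilbertMetric_add_smul (hD : IsStronglyConvexDomain D) (hx : x ∈ D)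
    (hv : v ≠ 0) {s : ℝ} (hs : x + s • v ∈ D) :
    (fundamentalTensor (hilbertMetric D) (x + s • v) v).det =
      (hilbertMetric D (x + s • v) v / hilbertMetric D x v) ^ (n + 1) *
        (fundamentalTensor (hilbertMetric D) x v).det := by
  have hΩ := isOpen_slitTangent hD.isOpen
  have hH := contDiffOn_hilbertMetric hD
  have hE := pd_hilbertMetric_radial hD
  have hp : (x, v) ∈ slitTangent D := mem_slitTangent.2 ⟨hx, hv⟩
  have hps : (x + s • v, v) ∈ slitTangent D := mem_slitTangent.2 ⟨hs, hv⟩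
  have hrad {y : Eucl n} (h : (y, v) ∈ slitTangent D) : dotProduct
      (fun i => pd (dirV i) (fun q : Eucl n × Eucl n => hilbertMetric D q.1 q.2) (y, v)) v.ofLp =
      hilbertMetric D y v := by
    rw [dotProduct_comm]
    exact (sum_mul_pd_dirV v _ _).trans (hE (y, v) h)
  rw [fundamentalTensor_hilbertMetric_eq hD hp, fundamentalTensor_hilbertMetric_eq hD hps]
  simp only [dirV, pd_pd_hilbertMetric_add_smul hD hx hv hs]
  refine det_smul_add_vecMulVec (v := v.ofLp) (hilbertMetric_pos hD hs hv)
    (hilbertMetric_pos hD hx hv) ?_ ?_ (hrad hps) (hrad hp)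
  · ext i j
    exact pd_comm hΩ hH hp
  · ext i
    refine (Finset.sum_congr rfl fun j _ => mul_comm _ _).trans
      ((sum_mul_pd_pd_dirV hΩ hH hp (dirV i) v).trans ?_)
    rw [pd_comm hΩ hH hp, dirV, pd_radial_pd_fibre hΩ hH hE hp]
    rfl

theorem partialV_smul {f : Eucl n → Eucl n → ℝ} {a c : ℝ} (hc : c ≠ 0)
    (h : ∀ w, f x (c • w) = a * f x w) (k : Fin n) (v : Eucl n) :
    partialV k f x (c • v) = a / c * partialV k f x v := by
  have h1 : (fun t : ℝ => f x (c • v + t • EuclideanSpace.single k (1 : ℝ))) =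
      fun t : ℝ => a * (fun s : ℝ => f x (v + s • EuclideanSpace.single k (1 : ℝ))) (c⁻¹ * t) := by
    ext t
    simp only
    rw [← h, smul_add, smul_smul, mul_inv_cancel_left₀ hc]
  simp only [partialV, lineDeriv]
  rw [h1, deriv_const_mul_field,
    deriv_comp_mul_left c⁻¹ (fun s : ℝ => f x (v + s • EuclideanSpace.single k (1 : ℝ))) 0,
    mul_zero, smul_eq_mul]
  ring

theorem fundamentalTensor_hilbertMetric_smul (hD : IsStronglyConvexDomain D) (hx : x ∈ D)
    {c : ℝ} (hc : 0 < c) (v : Eucl n) :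
    fundamentalTensor (hilbertMetric D) x (c • v) = fundamentalTensor (hilbertMetric D) x v := by
  ext i j
  have h1 : ∀ w, energy (hilbertMetric D) x (c • w) = c ^ 2 * energy (hilbertMetric D) x w := by
    intro w
    rw [energy, energy, hilbertMetric_smul hD hx hc.le]
    ring
  simp only [fundamentalTensor, Matrix.of_apply]
  rw [partialV_smul hc.ne' (partialV_smul hc.ne' h1 j) i]
  field_simp

end DeterminantAlongLine

/-! ### Calibrating forms and behaviour along lines -/

section Calibration

variable {n : ℕ} {D : Set (Eucl n)} {x y v w a b : Eucl n}

theorem funk_zero (hD : IsStronglyConvexDomain D) (hx : x ∈ D) : funk D (x, 0) = 0 := by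
  simpa using funk_smul (v := (0 : Eucl n)) hD hx le_rfl

/-- The exit point `y + T w` lies in the closure, so `ℓ y + T ℓ w ≤ ℓ b`. The right-hand side is the
Funk metric of the supporting half-space wherever `ℓ w ≥ 0`, up to exchanging sides of the
inequality. -/
theorem apply_div_le_funk (hD : IsStronglyConvexDomain D) {ℓ : Eucl n →L[ℝ] ℝ}
    (h1 : ∀ y ∈ D, ℓ y < ℓ b) (h2 : ∀ y ∈ closure D, ℓ y ≤ ℓ b) (hy : y ∈ D) (w : Eucl n) :
    ℓ w / (ℓ b - ℓ y) ≤ funk D (y, w) := by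
  rcases eq_or_ne w 0 with rfl | hw
  · simp [funk_zero hD hy]
  · have h3 := h2 _ (frontier_subset_closure (boundaryPoint_mem_frontier hD hy hw))
    have hT := boundaryTime_pos hD hy hw
    rw [boundaryPoint, map_add, map_smul, smul_eq_mul] at h3
    rw [funk, div_le_iff₀ (sub_pos.2 (h1 y hy)), ← div_eq_inv_mul, le_div_iff₀ hT]
    linarith

/-- Equality means that the exit point lies on the supporting hyperplane at `b`, which meets the
closure of `D` only in `b`. -/
theorem apply_div_eq_funk_iff (hD : IsStronglyConvexDomain D) {ℓ : Eucl n →L[ℝ] ℝ}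
    (h1 : ∀ y ∈ D, ℓ y < ℓ b) (h3 : ∀ y ∈ closure D, ℓ y = ℓ b → y = b) (hy : y ∈ D)
    (hw : w ≠ 0) : ℓ w / (ℓ b - ℓ y) = funk D (y, w) ↔ boundaryPoint D y w = b := by
  have hT := boundaryTime_pos hD hy hw
  have hpos := sub_pos.2 (h1 y hy)
  have hiff : ℓ w / (ℓ b - ℓ y) = funk D (y, w) ↔ ℓ (boundaryPoint D y w) = ℓ b := by
    rw [boundaryPoint, map_add, map_smul, smul_eq_mul, funk, div_eq_iff hpos.ne', ← div_eq_inv_mul,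
      eq_div_iff hT.ne']
    constructor <;> intro h <;> linarith
  rw [hiff]
  exact ⟨h3 _ (frontier_subset_closure (boundaryPoint_mem_frontier hD hy hw)), fun h => by rw [h]⟩

/-- Each pair of boundary points `a`, `b` gives a closed form which calibrates the lines from `a`
to `b`. -/
theorem exists_calibration (hD : IsStronglyConvexDomain D) (ha : a ∈ frontier D)
    (hb : b ∈ frontier D) : ∃ (f : Eucl n → ℝ) (θ : Eucl n → Eucl n →L[ℝ] ℝ),
      (∀ y ∈ D, HasFDerivAt f (θ y) y) ∧ ContinuousOn θ D ∧
      (∀ y ∈ D, ∀ w, θ y w ≤ hilbertMetric D y w) ∧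
      ∀ y ∈ D, ∀ w, w ≠ 0 → (θ y w = hilbertMetric D y w ↔
        boundaryPoint D y w = b ∧ boundaryPoint D y (-w) = a) := by
  obtain ⟨α, hα1, hα2, hα3⟩ := hD.exists_support ha
  obtain ⟨β, hβ1, hβ2, hβ3⟩ := hD.exists_support hb
  have hθ (y w : Eucl n) : ((1 / 2 : ℝ) • ((β b - β y)⁻¹ • β - (α a - α y)⁻¹ • α)) w =
      1 / 2 * (β w / (β b - β y) + α (-w) / (α a - α y)) := by
    simp only [smul_apply, sub_apply, smul_eq_mul, map_neg]
    ring
  -- The potential is half the logarithm of the ratio of the distances, measured by `α` and `β`, to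
  -- the supporting hyperplanes at `a` and `b`. Its differential is the mean of the two lower bounds
  -- for `k` and `k'`, so it equals `F` only if both bounds are attained.
  refine ⟨fun y => 1 / 2 * (Real.log (α a - α y) - Real.log (β b - β y)),
    fun y => (1 / 2 : ℝ) • ((β b - β y)⁻¹ • β - (α a - α y)⁻¹ • α), ?_, ?_, ?_, ?_⟩
  · intro y hy
    have h1 := ((α.hasFDerivAt (x := y)).const_sub (α a)).log (sub_pos.2 (hα1 y hy)).ne'
    have h2 := ((β.hasFDerivAt (x := y)).const_sub (β b)).log (sub_pos.2 (hβ1 y hy)).ne'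
    have h3 : ((1 / 2 : ℝ) • ((β b - β y)⁻¹ • β - (α a - α y)⁻¹ • α)) =
        (1 / 2 : ℝ) • ((α a - α y)⁻¹ • -α - (β b - β y)⁻¹ • -β) := by
      rw [smul_neg, smul_neg, neg_sub_neg]
    change HasFDerivAt _ ((1 / 2 : ℝ) • ((β b - β y)⁻¹ • β - (α a - α y)⁻¹ • α)) y
    rw [h3]
    exact (h1.sub h2).const_mul (1 / 2 : ℝ)
  · have h1 : ContinuousOn (fun y => (β b - β y)⁻¹ • β) D :=
      ((continuous_const.sub β.continuous).continuousOn.inv₀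
        fun y hy => (sub_pos.2 (hβ1 y hy)).ne').smul continuousOn_const
    have h2 : ContinuousOn (fun y => (α a - α y)⁻¹ • α) D :=
      ((continuous_const.sub α.continuous).continuousOn.inv₀
        fun y hy => (sub_pos.2 (hα1 y hy)).ne').smul continuousOn_const
    exact (h1.sub h2).const_smul (1 / 2 : ℝ)
  · intro y hy w
    rw [hθ, hilbertMetric_eq hD hy]
    have h1 := apply_div_le_funk hD hα1 hα2 hy (-w)
    have h2 := apply_div_le_funk hD hβ1 hβ2 hy w
    have h3 : revFunk D (y, w) = funk D (y, -w) := rfl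
    rw [h3]
    linarith
  · intro y hy w hw
    rw [← apply_div_eq_funk_iff hD hα1 hα3 hy (neg_ne_zero.2 hw),
      ← apply_div_eq_funk_iff hD hβ1 hβ3 hy hw, hθ, hilbertMetric_eq hD hy]
    have h1 := apply_div_le_funk hD hα1 hα2 hy (-w)
    have h2 := apply_div_le_funk hD hβ1 hβ2 hy w
    have h3 : revFunk D (y, w) = funk D (y, -w) := rfl
    rw [h3]
    constructor
    · intro h
      exact ⟨by linarith, by linarith⟩
    · rintro ⟨h4, h5⟩
      rw [h4, h5]

theorem boundaryTime_add_smul (hD : IsStronglyConvexDomain D) (hx : x ∈ D) (hv : v ≠ 0) {s : ℝ}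
    (hs : x + s • v ∈ D) : s < boundaryTime D x v ∧
      boundaryTime D (x + s • v) v = boundaryTime D x v - s := by
  have hT := boundaryTime_pos hD hx hv
  have hlt : s < boundaryTime D x v := by
    rcases le_or_gt 0 s with h | h
    · rw [add_smul_mem_iff hD hx h, ← lt_div_iff₀ (gauge_translate_pos hD hx hv), one_div] at hs
      rwa [boundaryTime_eq_inv_gauge hD hx]
    · exact h.trans hT
  refine ⟨hlt, boundaryTime_eq_of_mem_frontier hD hs (sub_pos.2 hlt) ?_⟩
  have := boundaryPoint_mem_frontier hD hx hv
  rw [boundaryPoint] at this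
  convert this using 1
  module

theorem boundaryPoint_smul (hD : IsStronglyConvexDomain D) (hx : x ∈ D) {c : ℝ} (hc : 0 < c)
    (v : Eucl n) : boundaryPoint D x (c • v) = boundaryPoint D x v := by
  rw [boundaryPoint, boundaryTime_smul hD hx hc.le, smul_smul, boundaryPoint]
  congr 2
  field_simp

theorem boundaryPoint_add_smul (hD : IsStronglyConvexDomain D) (hx : x ∈ D) (hv : v ≠ 0) {s c : ℝ}
    (hc : 0 < c) (hs : x + s • v ∈ D) :
    boundaryPoint D (x + s • v) (c • v) = boundaryPoint D x v := by
  rw [boundaryPoint_smul hD hs hc, boundaryPoint, (boundaryTime_add_smul hD hx hv hs).2,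
    boundaryPoint]
  module

theorem boundaryPoint_add_smul_neg (hD : IsStronglyConvexDomain D) (hx : x ∈ D) (hv : v ≠ 0)
    {s c : ℝ} (hc : 0 < c) (hs : x + s • v ∈ D) :
    boundaryPoint D (x + s • v) (-(c • v)) = boundaryPoint D x (-v) := by
  have h : s • v = (-s) • (-v) := by simp
  rw [h] at hs ⊢
  rw [← smul_neg]
  exact boundaryPoint_add_smul hD hx (neg_ne_zero.2 hv) hc hs

/-- A ray from `y` has to travel a distance of at least `r` before it leaves `D`. The estimate
controls `F` near zero vectors. -/
theorem hilbertMetric_le_of_ball_subset (hD : IsStronglyConvexDomain D) {r : ℝ} (hr : 0 < r)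
    (h : Metric.ball y r ⊆ D) (w : Eucl n) : hilbertMetric D y w ≤ ‖w‖ / r := by
  have hy : y ∈ D := h (Metric.mem_ball_self hr)
  have key : ∀ w : Eucl n, funk D (y, w) ≤ ‖w‖ / r := by
    intro w
    rcases eq_or_ne w 0 with rfl | hw
    · simp [funk_zero hD hy]
    · have hT := boundaryTime_pos hD hy hw
      have hb := boundaryPoint_mem_frontier hD hy hw
      rw [hD.isOpen.frontier_eq] at hb
      have hn : r ≤ ‖boundaryTime D y w • w‖ := by
        by_contra! hlt
        exact hb.2 (h (by simpa [boundaryPoint] using hlt))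
      rw [norm_smul, Real.norm_of_nonneg hT.le] at hn
      rw [funk, inv_le_iff_one_le_mul₀ hT, div_mul_eq_mul_div, one_le_div hr]
      linarith
  rw [hilbertMetric_eq hD hy]
  have h1 := key w
  have h2 := key (-w)
  rw [norm_neg] at h2
  have h3 : revFunk D (y, w) = funk D (y, -w) := rfl
  rw [h3]
  linarith

/-- The curves competing in `finslerDist` may have zero velocity, so integrability of their speed
needs continuity on the zero section as well. -/
theorem continuousOn_hilbertMetric (hD : IsStronglyConvexDomain D) :
    ContinuousOn (fun q : Eucl n × Eucl n => hilbertMetric D q.1 q.2) (D ×ˢ univ) := by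
  rintro ⟨x, v⟩ ⟨hx, -⟩
  refine ContinuousAt.continuousWithinAt ?_
  rcases eq_or_ne v 0 with rfl | hv
  · obtain ⟨r, hr, hball⟩ := Metric.isOpen_iff.1 hD.isOpen x hx
    have h0 : hilbertMetric D x 0 = 0 := by simp [hilbertMetric]
    have hlim : Filter.Tendsto (fun q : Eucl n × Eucl n => ‖q.2‖ / (r / 2)) (𝓝 (x, 0)) (𝓝 0) := by
      have : Continuous fun q : Eucl n × Eucl n => ‖q.2‖ / (r / 2) := by fun_prop
      simpa using this.tendsto (x, 0)
    unfold ContinuousAt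
    simp only [h0]
    refine tendsto_of_tendsto_of_tendsto_of_le_of_le' tendsto_const_nhds hlim
      (Filter.Eventually.of_forall fun q => hilbertMetric_nonneg D q.1 q.2) ?_
    have hnear : ∀ᶠ q : Eucl n × Eucl n in 𝓝 (x, 0), q.1 ∈ Metric.ball x (r / 2) :=
      continuousAt_fst.eventually (Metric.ball_mem_nhds x (half_pos hr))
    filter_upwards [hnear] with q hq
    refine hilbertMetric_le_of_ball_subset hD (half_pos hr) (subset_trans ?_ hball) q.2
    refine Metric.ball_subset_ball' ?_
    have := Metric.mem_ball.1 hq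
    linarith
  · exact ((contDiffOn_hilbertMetric hD).contDiffAt
      ((isOpen_slitTangent hD.isOpen).mem_nhds (mem_slitTangent.2 ⟨hx, hv⟩))).continuousAt

end Calibration

/-! ### Lengths and the Hilbert distance -/

section Length

variable {n : ℕ} {D : Set (Eucl n)} {x y v w a b : Eucl n} {f : Eucl n → ℝ}
  {θ : Eucl n → Eucl n →L[ℝ] ℝ} {γ γ' : ℝ → Eucl n}

theorem continuousOn_hilbertMetric_comp (hD : IsStronglyConvexDomain D) {s : Set ℝ}
    (hγ : ContinuousOn γ s) (hγ' : ContinuousOn γ' s) (hm : MapsTo γ s D) :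
    ContinuousOn (fun t => hilbertMetric D (γ t) (γ' t)) s :=
  ContinuousOn.comp (g := fun q : Eucl n × Eucl n => hilbertMetric D q.1 q.2)
    (f := fun t => (γ t, γ' t)) (continuousOn_hilbertMetric hD) (hγ.prodMk hγ')
    fun _ ht => ⟨hm ht, mem_univ _⟩

theorem integral_calibration {s₁ s₂ : ℝ} (hs : s₁ ≤ s₂)
    (hf : ∀ y ∈ D, HasFDerivAt f (θ y) y) (hθ : ContinuousOn θ D)
    (hγ : ContinuousOn γ (Icc s₁ s₂)) (hγ' : ContinuousOn γ' (Icc s₁ s₂))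
    (hm : MapsTo γ (Icc s₁ s₂) D) (hd : ∀ t ∈ Ioo s₁ s₂, HasDerivAt γ (γ' t) t) :
    ContinuousOn (fun t => θ (γ t) (γ' t)) (Icc s₁ s₂) ∧
      ∫ t in s₁..s₂, θ (γ t) (γ' t) = f (γ s₂) - f (γ s₁) := by
  have hc : ContinuousOn (fun t => θ (γ t) (γ' t)) (Icc s₁ s₂) := (hθ.comp hγ hm).clm_apply hγ'
  refine ⟨hc, intervalIntegral.integral_eq_sub_of_hasDerivAt_of_le (f := fun t => f (γ t)) hs
    ?_ ?_ (hc.intervalIntegrable_of_Icc hs)⟩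
  · exact ContinuousOn.comp (g := f) (fun y hy => (hf y hy).continuousAt.continuousWithinAt) hγ hm
  · intro t ht
    exact (hf _ (hm (Ioo_subset_Icc_self ht))).comp_hasDerivAt t (hd t ht)

theorem sub_le_integral_hilbertMetric (hD : IsStronglyConvexDomain D) {s₁ s₂ : ℝ} (hs : s₁ ≤ s₂)
    (hf : ∀ y ∈ D, HasFDerivAt f (θ y) y) (hθ : ContinuousOn θ D)
    (hle : ∀ y ∈ D, ∀ w, θ y w ≤ hilbertMetric D y w)
    (hγ : ContinuousOn γ (Icc s₁ s₂)) (hγ' : ContinuousOn γ' (Icc s₁ s₂))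
    (hm : MapsTo γ (Icc s₁ s₂) D) (hd : ∀ t ∈ Ioo s₁ s₂, HasDerivAt γ (γ' t) t) :
    f (γ s₂) - f (γ s₁) ≤ ∫ t in s₁..s₂, hilbertMetric D (γ t) (γ' t) := by
  obtain ⟨hc, hi⟩ := integral_calibration hs hf hθ hγ hγ' hm hd
  rw [← hi]
  exact intervalIntegral.integral_mono_on hs (hc.intervalIntegrable_of_Icc hs)
    ((continuousOn_hilbertMetric_comp hD hγ hγ' hm).intervalIntegrable_of_Icc hs)
    fun t ht => hle _ (hm ht) _

theorem integral_hilbertMetric_eq {s₁ s₂ : ℝ} (hs : s₁ ≤ s₂)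
    (hf : ∀ y ∈ D, HasFDerivAt f (θ y) y) (hθ : ContinuousOn θ D)
    (hγ : ContinuousOn γ (Icc s₁ s₂)) (hγ' : ContinuousOn γ' (Icc s₁ s₂))
    (hm : MapsTo γ (Icc s₁ s₂) D) (hd : ∀ t ∈ Ioo s₁ s₂, HasDerivAt γ (γ' t) t)
    (heq : ∀ t ∈ Icc s₁ s₂, θ (γ t) (γ' t) = hilbertMetric D (γ t) (γ' t)) :
    ∫ t in s₁..s₂, hilbertMetric D (γ t) (γ' t) = f (γ s₂) - f (γ s₁) := by
  rw [← (integral_calibration hs hf hθ hγ hγ' hm hd).2]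
  refine (intervalIntegral.integral_congr fun t ht => ?_).symm
  rw [uIcc_of_le hs] at ht
  exact heq t ht

theorem bddBelow_lengths (D : Set (Eucl n)) (x y : Eucl n) :
    BddBelow {L : ℝ | ∃ γ : ℝ → Eucl n, ContDiffOn ℝ 1 γ (Icc 0 1) ∧ MapsTo γ (Icc 0 1) D ∧
      γ 0 = x ∧ γ 1 = y ∧ L = ∫ t in (0 : ℝ)..1,
        hilbertMetric D (γ t) (derivWithin γ (Icc 0 1) t)} := by
  refine ⟨0, ?_⟩
  rintro _ ⟨γ, -, -, -, -, rfl⟩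
  exact intervalIntegral.integral_nonneg zero_le_one fun t _ => hilbertMetric_nonneg _ _ _

theorem derivWithin_segment (x u : Eucl n) {t : ℝ} (ht : t ∈ Icc (0 : ℝ) 1) :
    derivWithin (fun t : ℝ => x + t • u) (Icc 0 1) t = u :=
  ((hasDerivAt_line x u t).hasDerivWithinAt).derivWithin (uniqueDiffOn_Icc zero_lt_one t ht)

theorem integral_segment_mem_lengths (hD : IsStronglyConvexDomain D) (hx : x ∈ D) (hy : y ∈ D) :
    (∫ t in (0 : ℝ)..1, hilbertMetric D (x + t • (y - x)) (y - x)) ∈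
      {L : ℝ | ∃ γ : ℝ → Eucl n, ContDiffOn ℝ 1 γ (Icc 0 1) ∧ MapsTo γ (Icc 0 1) D ∧
        γ 0 = x ∧ γ 1 = y ∧ L = ∫ t in (0 : ℝ)..1,
          hilbertMetric D (γ t) (derivWithin γ (Icc 0 1) t)} := by
  refine ⟨fun t => x + t • (y - x), ?_, ?_, by simp, by simp, ?_⟩
  · have : ContDiff ℝ 1 fun t : ℝ => x + t • (y - x) := by fun_prop
    exact this.contDiffOn
  · intro t ht
    exact hD.convex.add_smul_sub_mem hx hy ht
  · refine intervalIntegral.integral_congr fun t ht => ?_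
    rw [uIcc_of_le zero_le_one] at ht
    simp only [derivWithin_segment _ _ ht]

theorem finslerDist_self (hD : IsStronglyConvexDomain D) (hx : x ∈ D) :
    finslerDist D (hilbertMetric D) x x = 0 := by
  refine le_antisymm ?_ (Real.sInf_nonneg ?_)
  · refine csInf_le (bddBelow_lengths D x x) ?_
    convert integral_segment_mem_lengths hD hx hx using 1
    simp [hilbertMetric]
  · rintro _ ⟨γ, -, -, -, -, rfl⟩
    exact intervalIntegral.integral_nonneg zero_le_one fun t _ => hilbertMetric_nonneg _ _ _

/-- The Hilbert distance is measured by the calibration along the line through the two points. -/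
theorem finslerDist_eq_sub (hD : IsStronglyConvexDomain D) (hx : x ∈ D) (hy : y ∈ D)
    (hxy : x ≠ y) (hf : ∀ y ∈ D, HasFDerivAt f (θ y) y) (hθ : ContinuousOn θ D)
    (hle : ∀ y ∈ D, ∀ w, θ y w ≤ hilbertMetric D y w)
    (heq : ∀ y ∈ D, ∀ w, w ≠ 0 → (θ y w = hilbertMetric D y w ↔
        boundaryPoint D y w = b ∧ boundaryPoint D y (-w) = a))
    (hb : boundaryPoint D x (y - x) = b) (ha : boundaryPoint D x (-(y - x)) = a) :
    finslerDist D (hilbertMetric D) x y = f y - f x := by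
  have hu : y - x ≠ 0 := sub_ne_zero.2 hxy.symm
  have hm : MapsTo (fun t : ℝ => x + t • (y - x)) (Icc 0 1) D :=
    fun t ht => hD.convex.add_smul_sub_mem hx hy ht
  have hcont : Continuous fun t : ℝ => x + t • (y - x) := by fun_prop
  have hseg : ∫ t in (0 : ℝ)..1, hilbertMetric D (x + t • (y - x)) (y - x) = f y - f x := by
    have := integral_hilbertMetric_eq (γ := fun t : ℝ => x + t • (y - x)) (γ' := fun _ => y - x)
      zero_le_one hf hθ hcont.continuousOn continuousOn_const hm
      (fun t _ => hasDerivAt_line x (y - x) t) fun t ht => by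
        rw [heq _ (hm ht) _ hu]
        have h1 := boundaryPoint_add_smul hD hx hu one_pos (hm ht)
        have h2 := boundaryPoint_add_smul_neg hD hx hu one_pos (hm ht)
        rw [one_smul] at h1 h2
        exact ⟨h1.trans hb, h2.trans ha⟩
    simpa using this
  have hmem := integral_segment_mem_lengths hD hx hy
  -- The segment is an admissible curve whose length is the increment of the potential; the
  -- calibration bounds the length of every other curve below by the same increment.
  refine le_antisymm ?_ (le_csInf ⟨_, hmem⟩ ?_)
  · rw [← hseg]
    exact csInf_le (bddBelow_lengths D x y) hmem
  · rintro _ ⟨γ, hγ, hγm, rfl, rfl, rfl⟩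
    refine sub_le_integral_hilbertMetric hD zero_le_one hf hθ hle hγ.continuousOn
      (hγ.continuousOn_derivWithin (uniqueDiffOn_Icc zero_lt_one) le_rfl) hγm fun t ht => ?_
    exact ((hγ.differentiableOn one_ne_zero t (Ioo_subset_Icc_self ht)).hasDerivWithinAt).hasDerivAt
      (Icc_mem_nhds ht.1 ht.2)

end Length

/-! ### Geodesics are lines -/

section Geodesics

variable {n : ℕ} {D : Set (Eucl n)} {x y v w a b : Eucl n}

theorem exists_calibration_of_direction (hD : IsStronglyConvexDomain D) (hx : x ∈ D) (hv : v ≠ 0) :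
    ∃ (f : Eucl n → ℝ) (θ : Eucl n → Eucl n →L[ℝ] ℝ),
      (∀ y ∈ D, HasFDerivAt f (θ y) y) ∧ ContinuousOn θ D ∧
      (∀ y ∈ D, ∀ w, θ y w ≤ hilbertMetric D y w) ∧
      ∀ y ∈ D, ∀ w, w ≠ 0 → (θ y w = hilbertMetric D y w ↔
        boundaryPoint D y w = boundaryPoint D x v ∧
        boundaryPoint D y (-w) = boundaryPoint D x (-v)) :=
  exists_calibration hD (boundaryPoint_mem_frontier hD hx (neg_ne_zero.2 hv))
    (boundaryPoint_mem_frontier hD hx hv)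

/-- Straight lines with unit speed are geodesics of the Hilbert metric. -/
theorem isGeodesicOn_line (hD : IsStronglyConvexDomain D) (hx : x ∈ D) (hv : v ≠ 0)
    {I : Set ℝ} {φ φ' : ℝ → ℝ} (hφs : ContDiff ℝ ∞ φ)
    (hφ : ∀ t, HasDerivAt φ (φ' t) t)
    (hφc : Continuous φ') (hmem : ∀ t, x + φ t • v ∈ D) (hpos : ∀ t, 0 < φ' t)
    (hunit : ∀ t, φ' t * hilbertMetric D (x + φ t • v) v = 1) :
    IsGeodesicOn D (hilbertMetric D) I fun t => x + φ t • v := by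
  have hder (t : ℝ) : HasDerivAt (fun t => x + φ t • v) (φ' t • v) t :=
    ((hφ t).smul_const v).const_add x
  have hF (t : ℝ) : hilbertMetric D (x + φ t • v) (φ' t • v) = 1 := by
    rw [hilbertMetric_smul hD (hmem t) (hpos t).le, hunit]
  have hcont : Continuous fun t => x + φ t • v :=
    continuous_const.add (hφs.continuous.smul continuous_const)
  -- The first `1` is the speed. The second is the radius of local minimality, which is arbitrary
  -- because the line minimizes between any two of its points.
  refine ⟨?_, fun t _ => hmem t, ⟨1, fun t _ => ?_⟩, fun t _ => ⟨1, one_pos, ?_⟩⟩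
  · exact (contDiff_const.add (hφs.smul contDiff_const)).contDiffOn
  · rw [(hder t).deriv, hF]
  · intro s₁ _ s₂ _ hs
    rcases hs.eq_or_lt with rfl | hlt
    · rw [intervalIntegral.integral_same, finslerDist_self hD (hmem s₁)]
    · obtain ⟨f, θ, hf, hθ, hle, heq⟩ := exists_calibration_of_direction hD hx hv
      have hmono : StrictMono φ := strictMono_of_hasDerivAt_pos hφ hpos
      have hc : 0 < φ s₂ - φ s₁ := sub_pos.2 (hmono hlt)
      have hsub : x + φ s₂ • v - (x + φ s₁ • v) = (φ s₂ - φ s₁) • v := by module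
      rw [finslerDist_eq_sub hD (hmem s₁) (hmem s₂) ?_ hf hθ hle heq ?_ ?_]
      · simp only [(hder _).deriv]
        refine integral_hilbertMetric_eq hs hf hθ hcont.continuousOn
          (hφc.smul continuous_const).continuousOn (fun t _ => hmem t) (fun t _ => hder t) ?_
        intro t _
        rw [heq _ (hmem t) _ (smul_ne_zero (hpos t).ne' hv)]
        exact ⟨boundaryPoint_add_smul hD hx hv (hpos t) (hmem t),
          boundaryPoint_add_smul_neg hD hx hv (hpos t) (hmem t)⟩
      · intro h
        rw [h, sub_self] at hsub
        exact smul_ne_zero hc.ne' hv hsub.symm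
      · rw [hsub]
        exact boundaryPoint_add_smul hD hx hv hc (hmem s₁)
      · rw [hsub]
        exact boundaryPoint_add_smul_neg hD hx hv hc (hmem s₁)

/-- A geodesic of the Hilbert metric with initial velocity `v` stays on the line in the direction
`v`. -/
theorem IsGeodesicOn.exists_eq_line (hD : IsStronglyConvexDomain D) {ε : ℝ} (hε : 0 < ε)
    {η : ℝ → Eucl n} (hη : IsGeodesicOn D (hilbertMetric D) (Ioo (-ε) ε) η) (h0 : η 0 = x)
    (hv0 : deriv η 0 = v) (hunit : hilbertMetric D x v = 1) :
    ∃ ψ μ : ℝ → ℝ, ψ 0 = 0 ∧ ∀ᶠ t in 𝓝 (0 : ℝ), t ∈ Ioo (-ε) ε ∧ η t ∈ D ∧ η t = x + ψ t • v ∧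
      HasDerivAt ψ (μ t) t ∧ deriv η t = μ t • v ∧ 0 < μ t ∧ μ t * hilbertMetric D (η t) v = 1 := by
  have h0mem : (0 : ℝ) ∈ Ioo (-ε) ε := ⟨by linarith, hε⟩
  have hx : x ∈ D := h0 ▸ hη.mapsTo h0mem
  have hv : v ≠ 0 := by
    rintro rfl
    simp [hilbertMetric] at hunit
  have hdiff : ∀ t ∈ Ioo (-ε) ε, HasDerivAt η (deriv η t) t := fun t ht =>
    ((hη.smooth.contDiffAt (isOpen_Ioo.mem_nhds ht)).differentiableAt (by simp)).hasDerivAt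
  have hcd : ContinuousOn (deriv η) (Ioo (-ε) ε) :=
    hη.smooth.continuousOn_deriv_of_isOpen isOpen_Ioo (by norm_cast)
  have hspeed : ∀ t ∈ Ioo (-ε) ε, hilbertMetric D (η t) (deriv η t) = 1 := by
    obtain ⟨c, hc⟩ := hη.constSpeed
    intro t ht
    rw [hc t ht, ← hc 0 h0mem, h0, hv0, hunit]
  have hne : ∀ t ∈ Ioo (-ε) ε, deriv η t ≠ 0 := by
    intro t ht h
    have := hspeed t ht
    simp [h, hilbertMetric] at this
  obtain ⟨δ, hδ, hloc⟩ := hη.locallyMinimizing 0 h0mem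
  obtain ⟨r, hr, hrε, hrδ⟩ : ∃ r > 0, r < ε ∧ r < δ :=
    ⟨min ε δ / 2, by positivity, by linarith [min_le_left ε δ, lt_min hε hδ],
      by linarith [min_le_right ε δ, lt_min hε hδ]⟩
  have hsub : Icc (-r) r ⊆ Ioo (-ε) ε := fun t ht => ⟨by linarith [ht.1], by linarith [ht.2]⟩
  have hlen := hloc (-r) ⟨⟨by linarith, by linarith⟩, by constructor <;> linarith⟩ r
    ⟨⟨by linarith, by linarith⟩, by constructor <;> linarith⟩ (by linarith)
  have hr1 : -r ∈ Icc (-r) r := ⟨le_rfl, by linarith⟩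
  have hr2 : r ∈ Icc (-r) r := ⟨by linarith, le_rfl⟩
  have hr0 : (0 : ℝ) ∈ Icc (-r) r := ⟨by linarith, hr.le⟩
  have hD1 := hη.mapsTo (hsub hr1)
  have hD2 := hη.mapsTo (hsub hr2)
  have hlen1 : ∫ s in (-r)..r, hilbertMetric D (η s) (deriv η s) = 2 * r := by
    have : ∫ s in (-r)..r, hilbertMetric D (η s) (deriv η s) = ∫ s in (-r)..r, (1 : ℝ) := by
      refine intervalIntegral.integral_congr fun t ht => ?_
      rw [uIcc_of_le (by linarith)] at ht
      exact hspeed t (hsub ht)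
    rw [this]
    simp
    ring
  have hends : η (-r) ≠ η r := by
    intro h
    rw [hlen1, h, finslerDist_self hD hD2] at hlen
    linarith
  have hu : η r - η (-r) ≠ 0 := sub_ne_zero.2 hends.symm
  -- The calibration belongs to the chord between the two ends of the minimizing arc.
  obtain ⟨f, θ, hf, hθ, hle, heq⟩ := exists_calibration_of_direction hD hD1 hu
  have hηc : ContinuousOn η (Icc (-r) r) := hη.smooth.continuousOn.mono hsub
  have hη'c : ContinuousOn (deriv η) (Icc (-r) r) := hcd.mono hsub
  have hηm : MapsTo η (Icc (-r) r) D := hη.mapsTo.mono_left hsub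
  obtain ⟨hθc, hθi⟩ := integral_calibration (by linarith) hf hθ hηc hη'c hηm
    fun t ht => hdiff t (hsub (Ioo_subset_Icc_self ht))
  -- Both integrals equal the increment of `f`: that of `θ` by exactness, that of `F` by minimality.
  -- As `θ ≤ F` and both are continuous along `η`, they agree everywhere.
  have hcal : ∀ t ∈ Icc (-r) r, θ (η t) (deriv η t) = hilbertMetric D (η t) (deriv η t) := by
    by_contra! hcon
    obtain ⟨t, ht, hne⟩ := hcon
    have := intervalIntegral.integral_lt_integral_of_continuousOn_of_le_of_exists_lt
      (by linarith : -r < r) hθc (continuousOn_hilbertMetric_comp hD hηc hη'c hηm)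
      (fun t ht => hle _ (hηm (Ioc_subset_Icc_self ht)) _)
      ⟨t, ht, lt_of_le_of_ne (hle _ (hηm ht) _) hne⟩
    rw [hθi, hlen, finslerDist_eq_sub hD hD1 hD2 hends hf hθ hle heq rfl rfl] at this
    exact lt_irrefl _ this
  -- Equality in the calibration means that all tangent lines of the arc meet the boundary in the
  -- same two points; the instant `t = 0` identifies them.
  have hbp : ∀ t ∈ Icc (-r) r, boundaryPoint D (η t) (deriv η t) = boundaryPoint D x v ∧
      boundaryPoint D (η t) (-deriv η t) = boundaryPoint D x (-v) := by
    intro t ht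
    have h1 := (heq _ (hηm ht) _ (hne t (hsub ht))).1 (hcal t ht)
    have h2 := (heq _ (hηm hr0) _ (hne 0 (hsub hr0))).1 (hcal 0 hr0)
    rw [h0, hv0] at h2
    exact ⟨h1.1.trans h2.1.symm, h1.2.trans h2.2.symm⟩
  set T := boundaryTime D x v with hT
  set T' := boundaryTime D x (-v) with hT'
  have hTpos : 0 < T := boundaryTime_pos hD hx hv
  have hTpos' : 0 < T' := boundaryTime_pos hD hx (neg_ne_zero.2 hv)
  set τ : ℝ → ℝ := fun t => boundaryTime D (η t) (deriv η t) with hτ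
  set τ' : ℝ → ℝ := fun t => boundaryTime D (η t) (-deriv η t) with hτ'
  -- Subtracting the two equations for the exit points eliminates `η t` and leaves `(τ + τ') η' = (T
  -- + T') v`.
  set μ : ℝ → ℝ := fun t => (T + T') / (τ t + τ' t) with hμ
  have hτpos : ∀ t ∈ Icc (-r) r, 0 < τ t ∧ 0 < τ' t := fun t ht =>
    ⟨boundaryTime_pos hD (hηm ht) (hne t (hsub ht)),
      boundaryTime_pos hD (hηm ht) (neg_ne_zero.2 (hne t (hsub ht)))⟩
  have hμpos : ∀ t ∈ Icc (-r) r, 0 < μ t := fun t ht =>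
    div_pos (add_pos hTpos hTpos') (add_pos (hτpos t ht).1 (hτpos t ht).2)
  have hημ : ∀ t ∈ Icc (-r) r, deriv η t = μ t • v ∧ η t = x + (T - τ t * μ t) • v := by
    intro t ht
    obtain ⟨h1, h2⟩ := hbp t ht
    obtain ⟨h3, h4⟩ := hτpos t ht
    simp only [boundaryPoint] at h1 h2
    change η t + τ t • deriv η t = x + T • v at h1
    change η t + τ' t • -deriv η t = x + T' • -v at h2
    have h5 : (τ t + τ' t) • deriv η t = (T + T') • v := by
      have := congrArg₂ (· - ·) h1 h2
      simp only [smul_neg] at this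
      calc (τ t + τ' t) • deriv η t = η t + τ t • deriv η t - (η t + -(τ' t • deriv η t)) := by
            module
        _ = _ := this
        _ = _ := by module
    have h6 : deriv η t = μ t • v := by
      have h7 : μ t = (τ t + τ' t)⁻¹ * (T + T') := div_eq_inv_mul _ _
      rw [h7, mul_smul, ← h5, smul_smul, inv_mul_cancel₀ (add_pos h3 h4).ne', one_smul]
    refine ⟨h6, ?_⟩
    rw [h6] at h1
    calc η t = η t + τ t • μ t • v - τ t • μ t • v := by abel
      _ = x + T • v - τ t • μ t • v := by rw [h1]
      _ = _ := by module
  have hvn : ‖v‖ ^ 2 ≠ 0 := pow_ne_zero 2 (norm_ne_zero_iff.2 hv)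
  -- The parameter also equals `T - τ μ`, but as an inner product it inherits its differentiability
  -- directly from `η`.
  set ψ : ℝ → ℝ := fun t => inner ℝ v (η t - x) / ‖v‖ ^ 2 with hψ
  have hψeq : ∀ t ∈ Icc (-r) r, η t = x + ψ t • v := by
    intro t ht
    have h1 := (hημ t ht).2
    have h2 : ψ t = T - τ t * μ t := by
      simp only [hψ]
      rw [h1, add_sub_cancel_left, inner_smul_right, real_inner_self_eq_norm_sq,
        mul_div_cancel_right₀ _ hvn]
    rw [h2, ← h1]
  refine ⟨ψ, μ, by simp [hψ, h0], ?_⟩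
  filter_upwards [Icc_mem_nhds (by linarith : -r < 0) hr] with t ht
  refine ⟨hsub ht, hηm ht, hψeq t ht, ?_, (hημ t ht).1, hμpos t ht, ?_⟩
  · have h1 : HasDerivAt (fun s => inner ℝ v (η s - x)) (inner ℝ v (deriv η t)) t :=
      (innerSL ℝ v).hasFDerivAt.comp_hasDerivAt t ((hdiff t (hsub ht)).sub_const x)
    have h2 := h1.div_const (‖v‖ ^ 2)
    rwa [(hημ t ht).1, inner_smul_right, real_inner_self_eq_norm_sq,
      mul_div_cancel_right₀ _ hvn] at h2
  · rw [← hilbertMetric_smul hD (hηm ht) (hμpos t ht).le, ← (hημ t ht).1]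
    exact hspeed t (hsub ht)

end Geodesics

/-! ### The density of Lebesgue measure -/

section Density

variable {n : ℕ} {D : Set (Eucl n)} {σ : Eucl n → ℝ}

/-- As `D` has finite measure, the density is determined almost everywhere; continuity on the open
set `D` removes the exceptional set. The weight is thereby independent of the chosen density. -/
theorem IsSmoothDensity.eq_one (hD : IsStronglyConvexDomain D)
    (h : IsSmoothDensity D (volume.restrict D) σ) : ∀ x ∈ D, σ x = 1 := by
  have hmeas := hD.isOpen.measurableSet
  have h1 := h.eq_withDensity
  rw [Measure.restrict_restrict hmeas, inter_self] at h1
  have hσ : AEMeasurable (fun x => ENNReal.ofReal (σ x)) (volume.restrict D) :=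
    (h.smooth.continuousOn.aemeasurable hmeas).ennreal_ofReal
  have hfin : ∫⁻ _, (1 : ENNReal) ∂(volume.restrict D) ≠ ⊤ := by
    rw [lintegral_one, Measure.restrict_apply_univ]
    exact hD.isBounded.measure_lt_top.ne
  have h2 : (volume.restrict D).withDensity (fun _ => 1) =
      (volume.restrict D).withDensity (fun x => ENNReal.ofReal (σ x)) := by
    rw [← h1]
    exact withDensity_one
  have h3 := (withDensity_eq_iff aemeasurable_const hσ hfin).1 h2
  have h4 : σ =ᵐ[volume.restrict D] fun _ => 1 := by
    filter_upwards [h3] with x hx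
    exact ENNReal.ofReal_eq_one.1 hx.symm
  exact Measure.eqOn_open_of_ae_eq h4 hD.isOpen h.smooth.continuousOn continuousOn_const

theorem isSmoothDensity_one (hD : IsStronglyConvexDomain D) :
    IsSmoothDensity D (volume.restrict D) fun _ => 1 where
  smooth := contDiffOn_const
  pos _ _ := one_pos
  eq_withDensity := by
    rw [Measure.restrict_restrict hD.isOpen.measurableSet, inter_self]
    simp only [ENNReal.ofReal_one]
    exact withDensity_one.symm

end Density

/-! ### The weight function along a geodesic -/

section Weight

variable {n : ℕ} {D : Set (Eucl n)} {x v : Eucl n}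

theorem add_smul_mem_of_mem_Ioo (hD : IsStronglyConvexDomain D) (hx : x ∈ D) {s : ℝ}
    (hs : s ∈ Ioo (-boundaryTime D x (-v)) (boundaryTime D x v)) : x + s • v ∈ D := by
  rcases le_or_gt 0 s with h | h
  · exact add_smul_mem_of_lt_boundaryTime hD hx h hs.2
  · have := add_smul_mem_of_lt_boundaryTime (v := -v) hD hx (neg_nonneg.2 h.le)
      (by linarith [hs.1])
    simpa using this

theorem hilbertMetric_add_smul (hD : IsStronglyConvexDomain D) (hx : x ∈ D) (hv : v ≠ 0) {s : ℝ}
    (hs : x + s • v ∈ D) : s < boundaryTime D x v ∧ -s < boundaryTime D x (-v) ∧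
      hilbertMetric D (x + s • v) v =
        1 / 2 * ((boundaryTime D x v - s)⁻¹ + (boundaryTime D x (-v) + s)⁻¹) := by
  have h : s • v = (-s) • (-v) := by simp
  have h1 := boundaryTime_add_smul hD hx hv hs
  have h2 := boundaryTime_add_smul (s := -s) hD hx (neg_ne_zero.2 hv) (by rwa [← h])
  rw [← h] at h2
  refine ⟨h1.1, h2.1, ?_⟩
  rw [hilbertMetric_eq hD hs, funk, revFunk, h1.2, h2.2, sub_neg_eq_add]

theorem inv_boundaryTime_add_inv (hD : IsStronglyConvexDomain D) (hx : x ∈ D)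
    (h : hilbertMetric D x v = 1) :
    (boundaryTime D x v)⁻¹ + (boundaryTime D x (-v))⁻¹ = 2 := by
  rw [hilbertMetric_eq hD hx, funk, revFunk] at h
  simp only at h
  linarith

/-- Since the density is `1`, `Ψ` is half the logarithm of `det g`. At `x + ψ v` the metric in
direction `v` is `F = (T + T') / (2 (T - ψ)(T' + ψ))`, so `Ψ = (n + 1) / 2 * log F + const`. Unit
speed means `ψ' = 1 / F`, which cancels the denominators and makes `Ψ'` affine in `ψ`. -/
theorem IsWeightAlong.deriv_eq (hD : IsStronglyConvexDomain D) (hx : x ∈ D)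
    (hunit : hilbertMetric D x v = 1) {ε : ℝ} {η : ℝ → Eucl n} {Ψ : ℝ → ℝ}
    (h : IsWeightAlong D (hilbertMetric D) (volume.restrict D) x v ε η Ψ) :
    deriv Ψ 0 = (n + 1) * (boundaryTime D x (-v) - boundaryTime D x v) /
        (boundaryTime D x v + boundaryTime D x (-v)) ∧
      deriv (deriv Ψ) 0 = 2 * (n + 1) / (boundaryTime D x v + boundaryTime D x (-v)) := by
  have hv : v ≠ 0 := by
    rintro rfl
    simp [hilbertMetric] at hunit
  obtain ⟨ψ, μ, hψ0, hline⟩ := h.geodesic.exists_eq_line hD h.pos h.start h.velocity hunit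
  obtain ⟨σ, hσ, hw⟩ := h.weight
  have hσ1 := hσ.eq_one hD
  set T := boundaryTime D x v with hT
  set T' := boundaryTime D x (-v) with hT'
  have hTpos : 0 < T := boundaryTime_pos hD hx hv
  have hTpos' : 0 < T' := boundaryTime_pos hD hx (neg_ne_zero.2 hv)
  have hsum : 0 < T + T' := add_pos hTpos hTpos'
  set d := (fundamentalTensor (hilbertMetric D) x v).det with hd
  have hdpos : 0 < d := (fundamentalTensor_hilbertMetric_posDef hD hx hv).det_pos
  have hμ : ∀ᶠ t in 𝓝 (0 : ℝ), HasDerivAt ψ (μ t) t ∧ 0 < T - ψ t ∧ 0 < T' + ψ t ∧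
      μ t = 2 * (T - ψ t) * (T' + ψ t) / (T + T') := by
    filter_upwards [hline] with t ⟨_, h2, h3, h4, _, _, h7⟩
    rw [h3] at h2 h7
    obtain ⟨h8, h9, h10⟩ := hilbertMetric_add_smul hD hx hv h2
    have h11 : 0 < T - ψ t := sub_pos.2 h8
    have h12 : 0 < T' + ψ t := by linarith
    refine ⟨h4, h11, h12, ?_⟩
    rw [h10, ← hT, ← hT'] at h7
    have h13 : μ t * (T + T') = 2 * (T - ψ t) * (T' + ψ t) := by
      field_simp at h7
      linarith
    rw [eq_div_iff hsum.ne', h13]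
  have hΨ : ∀ᶠ t in 𝓝 (0 : ℝ), Ψ t = (n + 1) / 2 *
      (Real.log ((T + T') / 2) - Real.log (T - ψ t) - Real.log (T' + ψ t)) +
        1 / 2 * Real.log d := by
    filter_upwards [hline, hμ] with t ⟨h1, h2, h3, _, h5, h6, _⟩ ⟨_, h8, h9, _⟩
    have h10 := hw t h1
    rw [hσ1 _ h2, h5, fundamentalTensor_hilbertMetric_smul hD h2 h6] at h10
    have hmem := h2
    rw [h3] at h10 hmem
    obtain ⟨_, _, h11⟩ := hilbertMetric_add_smul hD hx hv hmem
    have h12 : hilbertMetric D (x + ψ t • v) v = (T + T') / 2 / ((T - ψ t) * (T' + ψ t)) := by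
      rw [h11, ← hT, ← hT']
      field_simp
      ring
    have hFpos := hilbertMetric_pos hD hmem hv
    rw [det_fundamentalTensor_hilbertMetric_add_smul hD hx hv hmem, hunit, div_one] at h10
    have h13 := congrArg Real.log h10
    rw [Real.log_one, Real.log_mul (Real.exp_pos _).ne' (by positivity), Real.log_exp,
      Real.log_sqrt (by positivity), Real.log_mul (by positivity) hdpos.ne', Real.log_pow, h12,
      Real.log_div (by positivity) (by positivity), Real.log_mul h8.ne' h9.ne'] at h13
    push_cast at h13
    linarith
  have hd1 : ∀ᶠ t in 𝓝 (0 : ℝ), HasDerivAt Ψ ((n + 1) * (T' - T + 2 * ψ t) / (T + T')) t := by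
    filter_upwards [hμ, hΨ.eventually_nhds] with t ⟨h1, h2, h3, h4⟩ h5
    have h6 : HasDerivAt (fun t => (n + 1) / 2 *
      (Real.log ((T + T') / 2) - Real.log (T - ψ t) - Real.log (T' + ψ t)) +
        1 / 2 * Real.log d) ((n + 1) / 2 * (-(-μ t / (T - ψ t)) - μ t / (T' + ψ t))) t :=
      ((((h1.const_sub T).log h2.ne').const_sub _).sub
        ((h1.const_add T').log h3.ne')).const_mul _ |>.add_const _
    have h7 : (n + 1) / 2 * (-(-μ t / (T - ψ t)) - μ t / (T' + ψ t)) =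
        (n + 1) * (T' - T + 2 * ψ t) / (T + T') := by
      rw [h4]
      field_simp
      ring
    rw [← h7]
    exact h6.congr_of_eventuallyEq h5
  have hd2 : deriv Ψ =ᶠ[𝓝 0] fun t => (n + 1) * (T' - T + 2 * ψ t) / (T + T') :=
    hd1.mono fun t ht => ht.deriv
  have hμ0 : μ 0 = 1 := by
    have := hline.self_of_nhds.2.2.2.2.2.2
    rwa [h.start, hunit, mul_one] at this
  have hψd : HasDerivAt ψ 1 0 := hμ0 ▸ hμ.self_of_nhds.1
  have hd3 : HasDerivAt (fun t => (n + 1) * (T' - T + 2 * ψ t) / (T + T'))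
      ((n + 1) * (2 * 1) / (T + T')) 0 :=
    (((hψd.const_mul 2).const_add (T' - T)).const_mul ((n : ℝ) + 1)).div_const (T + T')
  refine ⟨?_, ?_⟩
  · rw [hd2.self_of_nhds]
    simp only [hψ0, mul_zero, add_zero]
  · rw [hd2.deriv_eq, hd3.deriv]
    ring

theorem exists_isWeightAlong (hD : IsStronglyConvexDomain D) (hx : x ∈ D)
    (hunit : hilbertMetric D x v = 1) : ∃ (ε : ℝ) (η : ℝ → Eucl n) (Ψ : ℝ → ℝ),
      IsWeightAlong D (hilbertMetric D) (volume.restrict D) x v ε η Ψ := by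
  have hv : v ≠ 0 := by
    rintro rfl
    simp [hilbertMetric] at hunit
  have hinv := inv_boundaryTime_add_inv hD hx hunit
  have hTpos : 0 < boundaryTime D x v := boundaryTime_pos hD hx hv
  have hTpos' : 0 < boundaryTime D x (-v) := boundaryTime_pos hD hx (neg_ne_zero.2 hv)
  obtain ⟨p, hp⟩ : ∃ p, p = (boundaryTime D x v)⁻¹ := ⟨_, rfl⟩
  obtain ⟨q, hq⟩ : ∃ q, q = (boundaryTime D x (-v))⁻¹ := ⟨_, rfl⟩
  have hT : boundaryTime D x v = p⁻¹ := by rw [hp, inv_inv]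
  have hT' : boundaryTime D x (-v) = q⁻¹ := by rw [hq, inv_inv]
  have hppos : 0 < p := hp ▸ inv_pos.2 hTpos
  have hqpos : 0 < q := hq ▸ inv_pos.2 hTpos'
  rw [← hp, ← hq] at hinv
  set e : ℝ → ℝ := fun t => Real.exp (2 * t) with he
  have hepos (t : ℝ) : 0 < e t := Real.exp_pos _
  have hden (t : ℝ) : 0 < q + p * e t := by have := hepos t; positivity
  -- This solves `φ' F = 1`: it is determined by `(T' + φ) / (T - φ) = e^{2t} T' / T`, since half
  -- the logarithm of that cross-ratio is arc length. Here `p = 1 / T`, `q = 1 / T'` and `p + q =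
  -- 2`.
  set φ : ℝ → ℝ := fun t => (e t - 1) / (q + p * e t) with hφ
  set φ' : ℝ → ℝ := fun t => 4 * e t / (q + p * e t) ^ 2 with hφ'
  have hes : ContDiff ℝ ∞ e := by fun_prop
  have hφs : ContDiff ℝ ∞ φ :=
    (hes.sub contDiff_const).div (contDiff_const.add (contDiff_const.mul hes))
      fun t => (hden t).ne'
  have hed (t : ℝ) : HasDerivAt e (e t * 2) t := by
    simpa using ((hasDerivAt_id t).const_mul 2).exp
  have hφd (t : ℝ) : HasDerivAt φ (φ' t) t := by
    have h1 := ((hed t).sub_const 1).div (((hed t).const_mul p).const_add q) (hden t).ne'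
    have h2 : φ' t = (e t * 2 * (q + p * e t) - (e t - 1) * (p * (e t * 2))) /
        (q + p * e t) ^ 2 := by
      simp only [hφ']
      congr 1
      linear_combination (-2 * e t) * hinv
    rw [h2]
    exact h1
  have hφc : Continuous φ' :=
    (continuous_const.mul hes.continuous).div
      ((continuous_const.add (continuous_const.mul hes.continuous)).pow 2)
      fun t => pow_ne_zero 2 (hden t).ne'
  have hpos (t : ℝ) : 0 < φ' t := by
    have h1 := hepos t
    have h2 := hden t
    positivity
  have h1 (t : ℝ) : boundaryTime D x v - φ t = 2 / (p * (q + p * e t)) := by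
    have h2 := hden t
    rw [hT, ← hinv]
    simp only [hφ]
    field_simp
    ring
  have h2 (t : ℝ) : boundaryTime D x (-v) + φ t = 2 * e t / (q * (q + p * e t)) := by
    have hne := (hden t).ne'
    rw [hT', inv_eq_one_div, div_add_div _ _ hqpos.ne' hne,
      div_eq_div_iff (mul_ne_zero hqpos.ne' hne) (mul_ne_zero hqpos.ne' hne)]
    linear_combination (q * (q + p * e t) * e t) * hinv
  have h3 (t : ℝ) : 0 < boundaryTime D x v - φ t := by
    have := hden t
    rw [h1]
    positivity
  have h4 (t : ℝ) : 0 < boundaryTime D x (-v) + φ t := by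
    have := hden t
    have := hepos t
    rw [h2]
    positivity
  have hmem (t : ℝ) : x + φ t • v ∈ D :=
    add_smul_mem_of_mem_Ioo hD hx ⟨by linarith [h4 t], by linarith [h3 t]⟩
  have hunit' (t : ℝ) : φ' t * hilbertMetric D (x + φ t • v) v = 1 := by
    rw [(hilbertMetric_add_smul hD hx hv (hmem t)).2.2, h1, h2]
    have h5 := hden t
    have h6 := hepos t
    simp only [hφ']
    field_simp
    ring
  have hφ0 : φ 0 = 0 := by simp [hφ, he]
  have hφ'0 : φ' 0 = 1 := by
    have := hunit' 0
    rwa [hφ0, zero_smul, add_zero, hunit, mul_one] at this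
  have hder (t : ℝ) : HasDerivAt (fun t => x + φ t • v) (φ' t • v) t :=
    ((hφd t).smul_const v).const_add x
  -- The curve is defined for all times, so `ε = 1` is arbitrary. With density `1`, the weight has
  -- to be the logarithm of `√det g`.
  refine ⟨1, fun t => x + φ t • v, fun t => Real.log (Real.sqrt (fundamentalTensor
    (hilbertMetric D) (x + φ t • v) (deriv (fun t => x + φ t • v) t)).det), one_pos,
    isGeodesicOn_line hD hx hv hφs hφd hφc hmem hpos hunit', by simp [hφ0],
    by rw [(hder 0).deriv, hφ'0, one_smul], fun _ => 1, isSmoothDensity_one hD, fun t _ => ?_⟩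
  have hdet : 0 < (fundamentalTensor (hilbertMetric D) (x + φ t • v)
      (deriv (fun t => x + φ t • v) t)).det := by
    rw [(hder t).deriv]
    exact (fundamentalTensor_hilbertMetric_posDef hD (hmem t)
      (smul_ne_zero (hpos t).ne' hv)).det_pos
  rw [Real.exp_neg, Real.exp_log (Real.sqrt_pos.2 hdet), inv_mul_cancel₀ (Real.sqrt_pos.2 hdet).ne']

end Weight

/-! ### The curvature bounds -/

theorem theorem2 (n : ℕ) (hn : 2 ≤ n) (D : Set (Eucl n)) (hD : IsStronglyConvexDomain D) :
    IsFinslerStructure D (hilbertMetric D) ∧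
    ∀ x ∈ D, ∀ v : Eucl n, hilbertMetric D x v = 1 →
      (∃ r ∈ Set.Ioc (-((n : ℝ) - 1)) 2,
        ∀ s : ℝ, IsWeightedRicciTop D (hilbertMetric D)
          (MeasureTheory.volume.restrict D) x v s ↔ s = r) ∧
      ∀ N : ℝ, (n : ℝ) < N →
        ∃ r ∈ Set.Ioc (-((n : ℝ) - 1) - ((n : ℝ) + 1) ^ 2 / (N - n)) 2,
          ∀ s : ℝ, IsWeightedRicci D (hilbertMetric D)
            (MeasureTheory.volume.restrict D) N x v s ↔ s = r := by
  refine ⟨isFinslerStructure_hilbertMetric hD, fun x hx v hunit => ?_⟩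
  have hv : v ≠ 0 := by
    rintro rfl
    simp [hilbertMetric] at hunit
  have hn1 : (0 : ℝ) < n + 1 := by positivity
  have hinv := inv_boundaryTime_add_inv hD hx hunit
  have hTpos : 0 < boundaryTime D x v := boundaryTime_pos hD hx hv
  have hTpos' : 0 < boundaryTime D x (-v) := boundaryTime_pos hD hx (neg_ne_zero.2 hv)
  have hRic : finslerRicci (hilbertMetric D) x v = -((n : ℝ) - 1) := by
    rw [finslerRicci_hilbertMetric hD hx hv, hunit]
    ring
  obtain ⟨ε, η, Ψ, hW⟩ := exists_isWeightAlong hD hx hunit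
  have huniq {ε : ℝ} {η : ℝ → Eucl n} {Ψ : ℝ → ℝ}
      (h : IsWeightAlong D (hilbertMetric D) (volume.restrict D) x v ε η Ψ) :=
    h.deriv_eq hD hx hunit
  generalize boundaryTime D x v = T at hinv hTpos huniq
  generalize boundaryTime D x (-v) = T' at hinv hTpos' huniq
  have hprod : T + T' = 2 * (T * T') := by
    field_simp at hinv
    linarith
  -- The harmonic mean of `T` and `T'` is `1`, so their arithmetic mean is at least `1`. This is the
  -- source of the upper bound `2 = -(n - 1) + (n + 1)`.
  have hsum : 2 ≤ T + T' := by nlinarith [sq_nonneg (T - T'), mul_pos hTpos hTpos']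
  have h2pos : 0 < 2 * ((n : ℝ) + 1) / (T + T') := by positivity
  have h2le : 2 * ((n : ℝ) + 1) / (T + T') ≤ n + 1 := by
    rw [div_le_iff₀ (by linarith)]
    nlinarith
  -- Strictness comes from `|T' - T| < T + T'`, as both times are positive.
  have h1sq : ((n + 1) * (T' - T) / (T + T')) ^ 2 < ((n : ℝ) + 1) ^ 2 := by
    rw [mul_div_assoc, mul_pow, div_pow]
    have : (T' - T) ^ 2 / (T + T') ^ 2 < 1 := by
      rw [div_lt_one (by positivity)]
      nlinarith [mul_pos hTpos hTpos']
    nlinarith [pow_pos hn1 2]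
  refine ⟨⟨-((n : ℝ) - 1) + 2 * (n + 1) / (T + T'), ⟨by linarith, by linarith⟩, fun s => ?_⟩,
    fun N hN => ⟨-((n : ℝ) - 1) + 2 * (n + 1) / (T + T') -
      ((n + 1) * (T' - T) / (T + T')) ^ 2 / (N - n), ⟨?_, ?_⟩, fun s => ?_⟩⟩
  · constructor
    · rintro ⟨ε, η, Ψ, h, rfl⟩
      rw [hRic, (huniq h).2]
    · rintro rfl
      exact ⟨ε, η, Ψ, hW, by rw [hRic, (huniq hW).2]⟩
  · have := div_lt_div_of_pos_right h1sq (sub_pos.2 hN)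
    linarith
  · have : 0 ≤ ((n + 1) * (T' - T) / (T + T')) ^ 2 / (N - n) :=
      div_nonneg (sq_nonneg _) (sub_pos.2 hN).le
    linarith
  · constructor
    · rintro ⟨ε, η, Ψ, h, rfl⟩
      rw [hRic, (huniq h).2, (huniq h).1]
    · rintro rfl
      exact ⟨ε, η, Ψ, hW, by rw [hRic, (huniq hW).2, (huniq hW).1]⟩
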